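/- **Setting.** Let $\mathcal X=[0,\zeta)$ with $0<\zeta\le+\infty$ carry its Borel $\sigma$-algebra $\mathcal A$, a $\sigma$-finite measure $\lambda$ and a measurable $s:\mathcal X\to[0,\infty)$ with $\int_{\mathcal X}s\,d\lambda<\infty$. Let $N^*$ be a counting process on $\mathcal X$ (paths vanishing at $0$, càdlàg, piecewise constant, nondecreasing, with jumps of size $+1$), identified with the random measure with distribution function $t\mapsto N^*([0,t])$, and let $Y^*$ be a measurable process on $\mathcal X$ with $0\le Y^*\le 1$. Assume that for a positive integer $k$ and a real $\kappa'>0$: * $N^*(\mathcal X)\le k$ a.s.; * $\mathbb E[N^*([0,t])]=\mathbb E\big[\int_{[0,t]}sY^*d\lambda\big]$ for all $t\in\mathcal X$; * $\mathrm{Var}\big[\int_I sY^*d\lambda\big]\le\kappa'\,\mathbb E\big[\int_I sY^*d\lambda\big]$ for all intervals $I\subset\mathcal X$. Let $N^1,\dots,N^n$ be i.i.d. random measures distributed as $N^*$ and let $Y^1,\dots,Y^n$ be i.i.d. measurable processes distributed as $Y^*$. Put $N=\sum_jN^j$, $Y=\sum_jY^j$, $dM=Y\,d\lambda$, and assume $\mathbb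 P[N(A)>0,\ M(A)=0]=0$ for all $A\in\mathcal A$. Write $H^2(f,g)=\int_{\mathcal X}(\sqrt f-\sqrt g)^2dM$, and let $\mathcal L$ be the cone of nonnegative jointly measurable $t:\mathcal X\times\Omega\to\mathbb R_+$ with $\mathbb E[\int t\,dM]<\infty$. **Models and estimators.** Let $\mathcal J=\{A\in\mathcal A:\mathbb E[M(A)]<\infty\}$. For a finite measurable partition $m$ of $\mathcal X$ into $|m|$ nonempty sets, let $S_m$ be the set of all $t=\sum_{I\in m\cap\mathcal J}t_I(\omega)1_I$ that belong to $\mathcal L$, $H^2(s,S_m)=\inf_{t\in S_m}H^2(s,t)$ (a random variable), and $\hat s_m=\sum_{I\in m\cap\mathcal J}\frac{N(I)}{M(I)}1_I$ (with $0/0=0$). Let $m\vee m'$ be the partition into the nonempty sets $I\cap I'$, $I\in m$, $I'\in m'$. Let $\mathcal M$ be a finite or countable family of such partitions for which there is $\delta\ge1$ with $|m\vee m'|\le\delta(|m|+|m'|)$ for all $m,m'\in\mathcal M$. Let $\Delta'_m\ge0$ ($m\in\mathcal M$) be weights with $$\Sigma'(\eta)=\sum_{m\in\mathcal M}e^{-\eta\Delta'_m}<\infty,\qquad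 \eta=k\Big(k+\int_{\mathcal X}s\,d\lambda\Big)^{-1},$$ and let $\mathrm{pen}:\mathcal M\to\mathbb R_+$ satisfy $\mathrm{pen}(m)\ge16\delta|m|(k+\kappa')+404k\Delta'_m$ for all $m\in\mathcal M$. **Selection.** For $m\ne m'$ in $\mathcal M$ let $$T_{m,m'}=H^2(\hat s_m,\hat s_{m\vee m'})-H^2(\hat s_{m'},\hat s_{m\vee m'})+16[\mathrm{pen}(m)-\mathrm{pen}(m')].$$ The test between $m$ and $m'$ decides $m$ (rejects $m'$) if $T_{m,m'}<0$, decides $m'$ (rejects $m$) if $T_{m,m'}>0$, and decides for one of them arbitrarily if $T_{m,m'}=0$. Let $\mathcal R_m$ be the set of the $m'\ne m$ in $\mathcal M$ such that the test between $m$ and $m'$ rejects $m$, and let $\mathcal D(m)=\sup_{m'\in\mathcal R_m}H^2(\hat s_m,\hat s_{m'})$ (with $\sup\varnothing=0$). Given $\varepsilon>0$, let $\hat m$ be any (random) element of $\mathcal M$ such that a.s. $\mathcal D(\hat m)\le\inf_{m\in\mathcal M}\mathcal D(m)+\varepsilon/3$. **Theorem.** Under these assumptions, $$\begin{aligned}\mathbb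 E\big[H^2(\hat s_{\hat m},s)\big]&\le390\Big(\mathbb E\Big[\inf_{m\in\mathcal M}\big(H^2(s,S_m)+\mathrm{pen}(m)\big)\Big]+404k\eta^{-1}[\Sigma'(\eta)]^2\Big)+\varepsilon\\&\le390\Big(\inf_{m\in\mathcal M}\big\{\mathbb E[H^2(s,S_m)]+\mathrm{pen}(m)\big\}+404k\eta^{-1}[\Sigma'(\eta)]^2\Big)+\varepsilon.\end{aligned}$$ -/

import Mathlib

open MeasureTheory ProbabilityTheory Set Filter Topology
open scoped ENNReal NNReal

noncomputable section

namespace PenHist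

/-! ### Finite partitions -/

/-- A finite partition of `X` (into nonempty sets); see `IsMeasurablePartition` for the requirement
that its elements be measurable.
The partition written `m ∨ m'` in statistics, consisting of the nonempty `I ∩ I'`
with `I ∈ m`, `I' ∈ m'`, is Mathlib's `m ⊓ m'`. -/
abbrev SetPartition (X : Type*) : Type _ := Finpartition (Set.univ : Set X)

open Classical in
/-- The common refinement `m ∨ m' = {I ∩ I' | I ∈ m, I' ∈ m', I ∩ I' ≠ ∅}`. -/
def refine {X : Type*} (m m' : SetPartition X) : SetPartition X := m ⊓ m'

open Classical in
/-- The refinement consists exactly of the nonempty intersections. -/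
theorem mem_refine_parts {X : Type*} (m m' : SetPartition X) (A : Set X) :
    A ∈ (refine m m').parts ↔
      A ≠ ∅ ∧ ∃ I ∈ m.parts, ∃ I' ∈ m'.parts, A = I ∩ I' := by
  unfold refine
  rw [Finpartition.parts_inf, Finset.mem_erase]
  simp only [Finset.mem_image, Finset.mem_product, Prod.exists]
  constructor
  · rintro ⟨h0, I, I', ⟨hI, hI'⟩, rfl⟩
    exact ⟨h0, I, hI, I', hI', rfl⟩
  · rintro ⟨h0, I, hI, I', hI', rfl⟩
    exact ⟨h0, I, I', ⟨hI, hI'⟩, rfl⟩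

/-! ### General framework: random measures `N` and `dM = Y dl` on a measurable space `X` -/

section Framework

variable {X Ω : Type*} [MeasurableSpace X] [MeasurableSpace Ω]

/-- The random measure `M` given by `dM = Y dl`. -/
def obsMeasure (l : Measure X) (Y : X → Ω → ℝ≥0) (ω : Ω) : Measure X :=
  l.withDensity fun x => (Y x ω : ℝ≥0∞)

/-- The squared quasi-distance `H²(f, g) = ∫ (√f - √g)² dM`, for one realization `M` of the
random measure. -/
def hellingerSq (M : Measure X) (f g : X → ℝ≥0) : ℝ≥0∞ :=
  ∫⁻ x, ENNReal.ofReal ((Real.sqrt (f x) - Real.sqrt (g x)) ^ 2) ∂M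

/-- The cone `𝓛` of nonnegative jointly measurable `t` with `E[∫ t dM] < ∞`. -/
def cone (P : Measure Ω) (M : Ω → Measure X) : Set (X → Ω → ℝ≥0) :=
  {t | Measurable (fun p : X × Ω => t p.1 p.2) ∧
    ∫⁻ ω, ∫⁻ x, (t x ω : ℝ≥0∞) ∂(M ω) ∂P < ∞}

/-- All elements of the partition are measurable. -/
def IsMeasurablePartition (m : SetPartition X) : Prop := ∀ I ∈ m.parts, MeasurableSet I

open Classical in
/-- `m ∩ 𝓙`: the elements `I` of the partition `m` such that `E[M(I)] < ∞`. -/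
def finiteParts (P : Measure Ω) (M : Ω → Measure X) (m : SetPartition X) : Finset (Set X) :=
  m.parts.filter fun I => ∫⁻ ω, M ω I ∂P < ∞

/-- The model `S_m`: the elements of the cone `𝓛` of the form `∑_{I ∈ m ∩ 𝓙} t_I 1_I`, with
possibly random real coefficients `t_I`. -/
def model (P : Measure Ω) (M : Ω → Measure X) (m : SetPartition X) : Set (X → Ω → ℝ≥0) :=
  {t | (∃ a : Set X → Ω → ℝ, ∀ x ω,
      (t x ω : ℝ) = ∑ I ∈ finiteParts P M m, I.indicator (fun _ => a I ω) x) ∧ t ∈ cone P M}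

/-- `H²(s, S_m) = inf_{t ∈ S_m} H²(s, t)`, a function of `ω`. -/
def biasSq (P : Measure Ω) (M : Ω → Measure X) (s : X → ℝ≥0) (m : SetPartition X) (ω : Ω) :
    ℝ≥0∞ :=
  ⨅ t ∈ model P M m, hellingerSq (M ω) s (fun x => t x ω)

/-- The histogram estimator `ŝ_m = ∑_{I ∈ m ∩ 𝓙} (N(I) / M(I)) 1_I`, with `0 / 0 = 0`, as
a function of `ω` and `x`. -/
def histEst (P : Measure Ω) (N M : Ω → Measure X) (m : SetPartition X) (ω : Ω) (x : X) : ℝ≥0 :=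
  ∑ I ∈ finiteParts P M m, I.indicator (fun _ => (N ω I / M ω I).toNNReal) x

/-- The test statistic
`T_{m,m'} = H²(ŝ_m, ŝ_{m∨m'}) - H²(ŝ_{m'}, ŝ_{m∨m'}) + 16 (pen m - pen m')`. -/
def testStat (P : Measure Ω) (N M : Ω → Measure X) (𝓜 : Set (SetPartition X)) (pen : 𝓜 → ℝ≥0)
    (ω : Ω) (m m' : 𝓜) : ℝ :=
  (hellingerSq (M ω) (histEst P N M m ω) (histEst P N M (refine m.1 m'.1) ω)).toReal
    - (hellingerSq (M ω) (histEst P N M m' ω) (histEst P N M (refine m.1 m'.1) ω)).toReal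
    + 16 * ((pen m : ℝ) - (pen m' : ℝ))

/-- `rej m m'` says that the test between the distinct models `m` and `m'` rejects `m`
(and so decides `m'`). The test decides `m` if `T_{m,m'} < 0` and `m'` if `T_{m,m'} > 0`; it
decides arbitrarily for one of the two if `T_{m,m'} = 0`. -/
structure IsTestOutcome {ι : Type*} (T : ι → ι → ℝ) (rej : ι → ι → Prop) : Prop where
  rejects_of_pos : ∀ m m', m ≠ m' → 0 < T m m' → rej m m'
  accepts_of_neg : ∀ m m', m ≠ m' → T m m' < 0 → ¬ rej m m'
  decides_one : ∀ m m', m ≠ m' → (rej m m' ↔ ¬ rej m' m)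

/-- `𝓓(m) = sup_{m' ∈ 𝓡_m} H²(ŝ_m, ŝ_{m'})`, where `𝓡_m` is the set of the `m' ≠ m` such that
the test between `m` and `m'` rejects `m` (and the supremum over the empty set is `0`). -/
def discrepancy (P : Measure Ω) (N M : Ω → Measure X) (𝓜 : Set (SetPartition X))
    (rej : 𝓜 → 𝓜 → Prop) (ω : Ω) (m : 𝓜) : ℝ≥0∞ :=
  ⨆ m' ∈ {m' : 𝓜 | m' ≠ m ∧ rej m m'},
    hellingerSq (M ω) (histEst P N M m ω) (histEst P N M m' ω)

/-- At `ω`, the model `mhat` is one that the selection procedure with penalty `pen` and tolerance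
`ε` may select: `𝓓(mhat) ≤ inf_m 𝓓(m) + ε / 3`, for some way of breaking ties in the tests. -/
def IsSelected (P : Measure Ω) (N M : Ω → Measure X) (𝓜 : Set (SetPartition X)) (pen : 𝓜 → ℝ≥0)
    (ε : ℝ) (ω : Ω) (mhat : 𝓜) : Prop :=
  ∃ rej : 𝓜 → 𝓜 → Prop, IsTestOutcome (testStat P N M 𝓜 pen ω) rej ∧
    discrepancy P N M 𝓜 rej ω mhat ≤
      (⨅ m : 𝓜, discrepancy P N M 𝓜 rej ω m) + ENNReal.ofReal (ε / 3)

end Framework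

/-! ### Counting processes on `[0, ζ)` -/

/-- The interval `[0, ζ)`, `0 < ζ ≤ ∞`, of `ℝ₊`, with its Borel `σ`-algebra. -/
abbrev TimeInterval (ζ : ℝ≥0∞) : Type := {x : ℝ≥0 // (x : ℝ≥0∞) < ζ}

/-- Paths of counting processes: they vanish at `0`, are nondecreasing, cadlag and piecewise
constant (constant on some interval `[t, t + h)` and on some interval `(t - h, t)`), and
their jumps have size `+1`. -/
structure IsCountingPath {ζ : ℝ≥0∞} (f : TimeInterval ζ → ℝ) : Prop where
  zero : ∀ t : TimeInterval ζ, (t : ℝ≥0) = 0 → f t = 0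
  mono : Monotone f
  right : ∀ t, ∀ᶠ u in 𝓝[≥] t, f u = f t
  left : ∀ t, ∃ c, (∀ᶠ u in 𝓝[<] t, f u = c) ∧ (f t = c ∨ f t = c + 1)

/-- The measure `μ` is the one associated with a path of a counting process: its cumulative
distribution function is that path. -/
def IsCountingMeasure {ζ : ℝ≥0∞} (μ : Measure (TimeInterval ζ)) : Prop :=
  ∃ f : TimeInterval ζ → ℝ, IsCountingPath f ∧ ∀ t, μ (Iic t) = ENNReal.ofReal (f t)

end PenHist

end

noncomputable section

namespace PenHist

/-! ### Exponential moments of Hellinger-type deviations -/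

/-! The proof separates an oracle inequality for a single realization from a moment bound for a
remainder.

Deterministic part. Let `V` be the refinement of `m` and `m'`, and let `s̄_V` have value `∫_J s dM /
M(J)` on each cell `J` of `V` with `E[M(J)] < ∞`, and `0` elsewhere. If, for all pairs at once,
`H²(ŝ_V, s̄_V) ≤ 2 (pen m + pen m') + U`, then every `m'` preferred to `m` satisfies `H²(ŝ_m,
ŝ_{m'}) ≤ 16 H²(s, t) + 64 pen m + 16 U` for `t ∈ S_m` (`hellingerSq_le_of_rejected`). This rests on
the fact that replacing a function by its cell averages is, up to a factor 2, optimal among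
piecewise constant functions for `H²`, and that `ŝ_m` is the average of `ŝ_V`. Comparing `mhat` with
`m` through whichever test outcome occurred gives `hellingerSq_selected_le`.

Stochastic part. The random `M` cancels cell by cell, so `H²(ŝ_V, s̄_V)` is at most the sum over `J`
of `(√N(J) - √∫_J s dM)²`. As `E[N(J)] = E[∫_J s dM]`, both square roots can be centred at the root
of this common mean. The deviations of `∫_J s dM` are bounded, for all partitions simultaneously, by
`∫ s (√Y - √E Y)² dl` (`sum_mean_dev_le`). Both kinds of deviation have exponential moments by
`lintegral_exp_sum_sq_sqrt_sub_le`: for a sum of independent nonnegative vectors of total mass at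
most 1, convexity of `exp` bounds the joint Laplace transform by that of independent Poisson
variables with the same means, although the coordinates may be dependent. Since `exp ((√a - √μ)² /
4)` is dominated by a countable mixture of normalised Poisson exponentials of mass at most `e⁴`,
expanding the product over cells gives the bound `e^{4 |F|}`.

The inequality `1 + u ≤ e^u` turns these moments into a threshold absorbed by the penalties plus a
remainder of mean of order `(k + ∫ s dl) e^{-η (Δ m + Δ m')}`. Summing over all pairs produces `S²`,
and `k / η = k + ∫ s dl`. -/

lemma exp_le_quadratic_of_nonpos {t : ℝ} (ht : t ≤ 0) : Real.exp t ≤ 1 + t + t ^ 2 / 2 := by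
  have h := Real.quadratic_le_exp_of_nonneg (x := -t) (by linarith)
  have h1 : Real.exp t * Real.exp (-t) = 1 := by rw [← Real.exp_add]; simp
  have h2 : 0 < Real.exp t := Real.exp_pos t
  have h3 : 0 < 1 + t + t ^ 2 / 2 := by nlinarith [sq_nonneg (t + 1)]
  have h4 : Real.exp t * (1 - t + t ^ 2 / 2) ≤ 1 := by nlinarith
  have h5 : 0 < 1 - t + t ^ 2 / 2 := by nlinarith
  have h6 : (1 - t + t ^ 2 / 2) * (1 + t + t ^ 2 / 2) = 1 + t ^ 4 / 4 := by ring
  by_contra hc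
  push Not at hc
  nlinarith [mul_lt_mul_of_pos_left hc h5, sq_nonneg (t ^ 2)]

/-- The tilting parameters used to dominate `exp ((√a - √μ)² / 4)` by a mixture of
Poisson-normalised exponentials. -/
def tilt (μ : ℝ) (j : ℕ × Bool) : ℝ :=
  if j.2 then 1 - √μ / (√μ + j.1 + 1) else -(j.1 / √μ)

/-- With `v = u`, the tilt `1 - m / v` would already give exponent at least `(u - m)²`, because
`e^{1 - m/v} ≤ v / m`. Rounding `v` up to the grid `m + ℕ + 1` costs at most `1`; the surplus over
`(u - m)² / 4` pays for that and for the weight `i / 4`. -/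
lemma upper_exponent_le {u m : ℝ} (hm : 0 ≤ m) (hu : m ≤ u) :
    ∃ i : ℕ, (u - m) ^ 2 / 4 ≤ 1 - (i : ℝ) / 4 +
      ((1 - m / (m + i + 1)) * u ^ 2 - m ^ 2 * (Real.exp (1 - m / (m + i + 1)) - 1)) := by
  refine ⟨⌊u - m⌋₊, ?_⟩
  have h1 := Nat.floor_le (sub_nonneg.2 hu)
  have h2 := Nat.lt_floor_add_one (u - m)
  set i := ⌊u - m⌋₊
  have hi : (i : ℝ) ≤ (i : ℝ) ^ 2 := by exact_mod_cast Nat.le_self_pow two_ne_zero i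
  have hi0 : (0 : ℝ) ≤ i := Nat.cast_nonneg i
  set v : ℝ := m + i + 1
  have hv : 0 < v := by positivity
  have hmv : m / v ≤ 1 := by rw [div_le_one hv]; simp only [v]; linarith
  have key : m ^ 2 * (Real.exp (1 - m / v) - 1) ≤ m * (v - m) := by
    rcases hm.eq_or_lt with rfl | hm'
    · simp
    have e1 : m / v ≤ Real.exp (-(1 - m / v)) := by
      have := Real.add_one_le_exp (-(1 - m / v)); linarith
    have e2 : Real.exp (1 - m / v) * Real.exp (-(1 - m / v)) = 1 := by
      rw [← Real.exp_add]; simp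
    have e3 : Real.exp (1 - m / v) * (m / v) ≤ 1 := by
      nlinarith [Real.exp_pos (1 - m / v)]
    have e4 : Real.exp (1 - m / v) * m ≤ v := by
      rw [mul_div_assoc', div_le_one hv] at e3; exact e3
    nlinarith
  have id : (1 - m / v) * u ^ 2 - m * (v - m) = (u - m) ^ 2 - (u - v) ^ 2 * (m / v) := by
    field_simp
    ring
  have hb : (u - v) ^ 2 * (m / v) ≤ 1 := by
    have : (u - v) ^ 2 ≤ 1 := by
      have a1 : -1 ≤ u - v := by simp only [v]; linarith
      have a2 : u - v ≤ 0 := by simp only [v]; linarith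
      nlinarith
    have : 0 ≤ m / v := by positivity
    nlinarith [sq_nonneg (u - v)]
  nlinarith

/-- With `i = ⌊m - u⌋`, the quadratic bound on `exp` and `u² / m ≤ u` make the exponent at least `i
(m - u) - i² / 2`, enough to cover `(u - m)² / 4` up to the constant and the weight. -/
lemma lower_exponent_le {u m : ℝ} (hu0 : 0 ≤ u) (hu : u < m) :
    ∃ i : ℕ, (u - m) ^ 2 / 4 ≤ 1 - (i : ℝ) / 4 +
      (-(i / m) * u ^ 2 - m ^ 2 * (Real.exp (-(i / m)) - 1)) := by
  have hm : 0 < m := hu0.trans_lt hu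
  refine ⟨⌊m - u⌋₊, ?_⟩
  have h1 := Nat.floor_le (sub_nonneg.2 hu.le)
  have h2 := Nat.lt_floor_add_one (m - u)
  set i := ⌊m - u⌋₊
  have hi : (i : ℝ) ≤ (i : ℝ) ^ 2 := by exact_mod_cast Nat.le_self_pow two_ne_zero i
  have hi0 : (0 : ℝ) ≤ i := Nat.cast_nonneg i
  have hq := exp_le_quadratic_of_nonpos (t := -((i : ℝ) / m)) (by simp; positivity)
  have e1 : m ^ 2 * (Real.exp (-((i : ℝ) / m)) - 1) ≤ m ^ 2 * (-(i / m) + (-(i / m)) ^ 2 / 2) :=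
    mul_le_mul_of_nonneg_left (by linarith) (sq_nonneg m)
  have e2 : m ^ 2 * (-((i : ℝ) / m) + (-(i / m)) ^ 2 / 2) = - i * m + i ^ 2 / 2 := by
    field_simp
  have e3 : (i : ℝ) / m * u ^ 2 ≤ i * u := by
    rw [div_mul_eq_mul_div, div_le_iff₀ hm]
    nlinarith [mul_nonneg hi0 hu0]
  nlinarith

lemma exp_sq_le_tilt {a μ : ℝ} (ha : 0 ≤ a) (hμ : 0 ≤ μ) : ∃ j : ℕ × Bool,
    Real.exp ((√a - √μ) ^ 2 / 4) ≤ Real.exp (1 - (j.1 : ℝ) / 4) *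
      Real.exp (tilt μ j * a - μ * (Real.exp (tilt μ j) - 1)) := by
  have ha' := Real.sq_sqrt ha
  have hμ' := Real.sq_sqrt hμ
  rcases le_or_gt (√μ) (√a) with h | h
  · obtain ⟨i, hi⟩ := upper_exponent_le (Real.sqrt_nonneg μ) h
    refine ⟨(i, true), ?_⟩
    rw [← Real.exp_add, Real.exp_le_exp]
    simpa [tilt, ha', hμ'] using hi
  · obtain ⟨i, hi⟩ := lower_exponent_le (Real.sqrt_nonneg a) h
    refine ⟨(i, false), ?_⟩
    rw [← Real.exp_add, Real.exp_le_exp]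
    simpa [tilt, ha', hμ'] using hi

lemma tsum_tilt_weight_le :
    ∑' j : ℕ × Bool, ENNReal.ofReal (Real.exp (1 - (j.1 : ℝ) / 4)) ≤
      ENNReal.ofReal (Real.exp 4) := by
  rw [ENNReal.tsum_prod (f := fun (i : ℕ) (_ : Bool) => ENNReal.ofReal (Real.exp (1 - (i : ℝ) / 4)))]
  simp only [tsum_fintype, Finset.sum_const, Finset.card_univ, Fintype.card_bool]
  have hr : Real.exp (-(1 / 4)) ≤ 4 / 5 := by
    rw [Real.exp_neg, inv_le_comm₀ (Real.exp_pos _) (by norm_num)]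
    have := Real.add_one_le_exp (1 / 4 : ℝ)
    norm_num at this ⊢
    linarith
  have hterm : ∀ i : ℕ, Real.exp (1 - (i : ℝ) / 4) ≤ Real.exp 1 * (4 / 5 : ℝ) ^ i := by
    intro i
    rw [show 1 - (i : ℝ) / 4 = 1 + i * (-(1 / 4)) by ring, Real.exp_add, Real.exp_nat_mul]
    gcongr
  have hg : HasSum (fun i : ℕ => 2 * (Real.exp 1 * (4 / 5 : ℝ) ^ i)) (2 * (Real.exp 1 * 5)) := by
    have := hasSum_geometric_of_lt_one (r := (4 / 5 : ℝ)) (by norm_num) (by norm_num)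
    norm_num at this
    exact (this.mul_left _).mul_left _
  -- The factor 2 counts the two signs of the tilt, and 5 is the sum of the geometric series of
  -- ratio `4 / 5 ≥ e^{-1/4}`.
  have hle : 2 * (Real.exp 1 * 5) ≤ Real.exp 4 := by
    have h1 : (2.7 : ℝ) ≤ Real.exp 1 := by have := Real.exp_one_gt_d9; linarith
    have h3 : Real.exp 4 = Real.exp 1 * Real.exp 1 ^ 3 := by
      rw [← Real.exp_nat_mul, ← Real.exp_add]; norm_num
    have h2 : (2.7 : ℝ) ^ 3 ≤ Real.exp 1 ^ 3 := by gcongr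
    rw [h3]
    nlinarith [Real.exp_pos 1]
  refine le_trans ?_ (ENNReal.ofReal_le_ofReal hle)
  rw [← hg.tsum_eq, ENNReal.ofReal_tsum_of_nonneg (fun i => by positivity) hg.summable]
  refine ENNReal.tsum_le_tsum fun i => ?_
  rw [ENNReal.ofReal_mul (by norm_num)]
  simp only [nsmul_eq_mul, Nat.cast_ofNat, ENNReal.ofReal_ofNat]
  gcongr
  exact hterm i

/-- If each factor `G i` is dominated by a countable mixture of the `E i t`, and the products of the
`E i t` have integral at most `1`, then so is `∏ i, G i`, up to the product of the masses. -/
lemma lintegral_prod_le_of_mixture {Ω ι J : Type*} [MeasurableSpace Ω] [Fintype ι] [Countable J]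
    (P : Measure Ω) (w : J → ℝ≥0∞) (θ : ι → J → ℝ) (E : ι → ℝ → Ω → ℝ≥0∞)
    (hE : ∀ i t, Measurable (E i t)) (G : ι → Ω → ℝ≥0∞) (hGm : ∀ i, Measurable (G i))
    (hG : ∀ᵐ ω ∂P, ∀ i, ∃ j, G i ω ≤ w j * E i (θ i j) ω)
    (h : ∀ t : ι → ℝ, ∫⁻ ω, ∏ i, E i (t i) ω ∂P ≤ 1) :
    ∫⁻ ω, ∏ i, G i ω ∂P ≤ (∑' j, w j) ^ Fintype.card ι := by
  classical
  -- Factors are exchanged one at a time. The claim must hold for every `t`, since adding `a` to `A`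
  -- applies the induction hypothesis with `t a` replaced by each `θ a j`.
  suffices H : ∀ A : Finset ι, ∀ t : ι → ℝ,
      ∫⁻ ω, (∏ i ∈ A, G i ω) * ∏ i ∈ Aᶜ, E i (t i) ω ∂P ≤ (∑' j, w j) ^ A.card by
    simpa using H Finset.univ 0
  intro A
  induction A using Finset.induction_on with
  | empty => simpa using h
  | insert a A ha ih =>
    intro t
    have hc : Aᶜ = insert a (insert a A)ᶜ := by
      ext x; by_cases hx : x = a <;> simp [hx, ha]
    have hna : a ∉ (insert a A)ᶜ := by simp
    calc ∫⁻ ω, (∏ i ∈ insert a A, G i ω) * ∏ i ∈ (insert a A)ᶜ, E i (t i) ω ∂P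
        ≤ ∫⁻ ω, ∑' j, w j * ((∏ i ∈ A, G i ω) *
            ∏ i ∈ Aᶜ, E i (Function.update t a (θ a j) i) ω) ∂P := by
          refine lintegral_mono_ae ?_
          filter_upwards [hG] with ω hω
          obtain ⟨j, hj⟩ := hω a
          refine le_trans ?_ (ENNReal.le_tsum j)
          rw [Finset.prod_insert ha, hc, Finset.prod_insert hna, Function.update_self]
          have : ∏ i ∈ (insert a A)ᶜ, E i (Function.update t a (θ a j) i) ω =
              ∏ i ∈ (insert a A)ᶜ, E i (t i) ω := by
            refine Finset.prod_congr rfl fun i hi => ?_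
            rw [Function.update_of_ne (by rintro rfl; exact hna hi)]
          rw [this]
          calc _ ≤ (w j * E a (θ a j) ω) * (∏ i ∈ A, G i ω) *
              ∏ i ∈ (insert a A)ᶜ, E i (t i) ω := by gcongr
            _ = _ := by ring
      _ = ∑' j, w j * ∫⁻ ω, (∏ i ∈ A, G i ω) *
            ∏ i ∈ Aᶜ, E i (Function.update t a (θ a j) i) ω ∂P := by
          have hm : ∀ j, Measurable fun ω => (∏ i ∈ A, G i ω) *
            ∏ i ∈ Aᶜ, E i (Function.update t a (θ a j) i) ω := fun j =>
            (Finset.measurable_prod _ fun i _ => hGm i).mul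
              (Finset.measurable_prod _ fun i _ => hE i _)
          rw [lintegral_tsum fun j => ((hm j).const_mul _).aemeasurable]
          simp_rw [lintegral_const_mul _ (hm _)]
      _ ≤ ∑' j, w j * (∑' j, w j) ^ A.card := by
          gcongr with j
          exact ih _
      _ = _ := by
          rw [ENNReal.tsum_mul_right, Finset.card_insert_of_notMem ha, pow_succ']

/-- Jensen's inequality for `exp`, with the missing mass `1 - ∑ v i` placed at `0`. -/
lemma exp_sum_mul_le {ι : Type*} [Fintype ι] (v θ : ι → ℝ) (hv : ∀ i, 0 ≤ v i)
    (hs : ∑ i, v i ≤ 1) :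
    Real.exp (∑ i, θ i * v i) ≤ 1 + ∑ i, v i * (Real.exp (θ i) - 1) := by
  have h := convexOn_exp.map_add_sum_le (t := Finset.univ) (w := v) (p := θ)
    (v := 1 - ∑ i, v i) (q := 0) (fun i _ => hv i) (by ring) (fun _ _ => mem_univ _)
    (by linarith) (mem_univ _)
  simp only [smul_eq_mul, mul_zero, zero_add, Real.exp_zero, mul_one] at h
  simp only [mul_sub, mul_one, Finset.sum_sub_distrib]
  simp only [mul_comm (θ _)]
  linarith

/-! ### Sums of independent vectors: comparison with Poisson Laplace transforms. -/

section Independent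

variable {Ω ι : Type*} [MeasurableSpace Ω] [Fintype ι] {P : Measure Ω} [IsProbabilityMeasure P]
  {n : ℕ} {a : Fin n → Ω → ι → ℝ}

lemma integrable_of_nonneg_of_sum_le_one (ham : ∀ j, Measurable (a j))
    (ha0 : ∀ j, ∀ᵐ ω ∂P, ∀ i, 0 ≤ a j ω i) (ha1 : ∀ j, ∀ᵐ ω ∂P, ∑ i, a j ω i ≤ 1) (j : Fin n)
    (i : ι) : Integrable (fun ω => a j ω i) P := by
  refine Integrable.of_bound ((measurable_pi_iff.1 (ham j) i).aestronglyMeasurable) 1 ?_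
  filter_upwards [ha0 j, ha1 j] with ω h0 h1
  rw [Real.norm_of_nonneg (h0 i)]
  exact (Finset.single_le_sum (f := fun i => a j ω i) (fun i _ => h0 i)
    (Finset.mem_univ i)).trans h1

lemma mgf_sum_le_of_sum_le_one (ham : ∀ j, Measurable (a j)) (hind : iIndepFun a P)
    (ha0 : ∀ j, ∀ᵐ ω ∂P, ∀ i, 0 ≤ a j ω i) (ha1 : ∀ j, ∀ᵐ ω ∂P, ∑ i, a j ω i ≤ 1) (θ : ι → ℝ) :
    mgf (∑ j, fun ω => ∑ i, θ i * a j ω i) P 1 ≤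
      Real.exp (∑ i, (∑ j, ∫ ω, a j ω i ∂P) * (Real.exp (θ i) - 1)) := by
  have hint := integrable_of_nonneg_of_sum_le_one ham ha0 ha1
  have hgm : Measurable fun x : ι → ℝ => ∑ i, θ i * x i := by fun_prop
  have hi := hind.comp (fun _ x => ∑ i, θ i * x i) fun _ => hgm
  have hs : ∑ i, (∑ j, ∫ ω, a j ω i ∂P) * (Real.exp (θ i) - 1) =
      ∑ j, ∑ i, (∫ ω, a j ω i ∂P) * (Real.exp (θ i) - 1) := by
    simp_rw [Finset.sum_mul]
    exact Finset.sum_comm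
  have := hi.mgf_sum (t := 1) (fun j => hgm.comp (ham j)) Finset.univ
  simp only [Function.comp_def] at this
  rw [this, hs, Real.exp_sum]
  refine Finset.prod_le_prod (fun _ _ => mgf_nonneg) fun j _ => ?_
  have h1 : mgf (fun ω => ∑ i, θ i * a j ω i) P 1 ≤
      ∫ ω, (1 + ∑ i, a j ω i * (Real.exp (θ i) - 1)) ∂P := by
    refine integral_mono_of_nonneg (ae_of_all _ fun _ => (Real.exp_pos _).le)
      ((integrable_const _).add (integrable_finsetSum _ fun i _ => (hint j i).mul_const _)) ?_
    filter_upwards [ha0 j, ha1 j] with ω h0 h1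
    simpa using exp_sum_mul_le (a j ω) θ h0 h1
  refine h1.trans ?_
  rw [integral_add (integrable_const _) (integrable_finsetSum _ fun i _ => (hint j i).mul_const _),
    integral_finsetSum _ fun i _ => (hint j i).mul_const _]
  simp only [integral_mul_const, integral_const, probReal_univ, smul_eq_mul, mul_one]
  have := Real.add_one_le_exp (∑ i, (∫ ω, a j ω i ∂P) * (Real.exp (θ i) - 1))
  linarith

/-- The product is `exp (∑ θ i S i)` divided by the Laplace transform of independent Poisson
variables with the means of the `S i`, which dominates that of `S`. No independence between
coordinates is needed. -/
lemma lintegral_prod_exp_le_one (ham : ∀ j, Measurable (a j)) (hind : iIndepFun a P)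
    (ha0 : ∀ j, ∀ᵐ ω ∂P, ∀ i, 0 ≤ a j ω i) (ha1 : ∀ j, ∀ᵐ ω ∂P, ∑ i, a j ω i ≤ 1) (θ : ι → ℝ) :
    ∫⁻ ω, ∏ i, ENNReal.ofReal (Real.exp (θ i * (∑ j, a j ω i) -
      (∑ j, ∫ ω, a j ω i ∂P) * (Real.exp (θ i) - 1))) ∂P ≤ 1 := by
  have hmeas : ∀ j i, Measurable fun ω => a j ω i := fun j i => measurable_pi_iff.1 (ham j) i
  set C := ∑ i, (∑ j, ∫ ω, a j ω i ∂P) * (Real.exp (θ i) - 1)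
  have heq : ∀ ω, ∏ i, ENNReal.ofReal (Real.exp (θ i * (∑ j, a j ω i) -
      (∑ j, ∫ ω, a j ω i ∂P) * (Real.exp (θ i) - 1))) =
      ENNReal.ofReal (Real.exp (-C)) *
        ENNReal.ofReal (Real.exp ((∑ j, fun ω => ∑ i, θ i * a j ω i) ω)) := by
    intro ω
    rw [← ENNReal.ofReal_mul (Real.exp_pos _).le, ← Real.exp_add,
      ← ENNReal.ofReal_prod_of_nonneg fun _ _ => (Real.exp_pos _).le, ← Real.exp_sum]
    congr 2
    simp only [Finset.sum_sub_distrib, Finset.sum_apply, C]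
    rw [Finset.sum_comm (s := (Finset.univ : Finset (Fin n)))]
    simp only [Finset.mul_sum]
    ring
  have hint : Integrable (fun ω => Real.exp ((∑ j, fun ω => ∑ i, θ i * a j ω i) ω)) P := by
    refine Integrable.of_bound (C := Real.exp (n * ∑ i, |θ i|)) ?_ ?_
    · simp only [Finset.sum_apply]
      have : Measurable fun ω => Real.exp (∑ j, ∑ i, θ i * a j ω i) :=
        Real.measurable_exp.comp (Finset.measurable_sum _ fun j _ =>
          Finset.measurable_sum _ fun i _ => (hmeas j i).const_mul _)
      exact this.aestronglyMeasurable
    · filter_upwards [ae_all_iff.2 ha0, ae_all_iff.2 ha1] with ω h0 h1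
      rw [Real.norm_of_nonneg (Real.exp_pos _).le, Real.exp_le_exp, Finset.sum_apply]
      calc ∑ j, ∑ i, θ i * a j ω i ≤ ∑ _j : Fin n, ∑ i, |θ i| := by
            refine Finset.sum_le_sum fun j _ => Finset.sum_le_sum fun i _ => ?_
            have : a j ω i ≤ 1 := (Finset.single_le_sum (f := fun i => a j ω i)
              (fun i _ => h0 j i) (Finset.mem_univ i)).trans (h1 j)
            nlinarith [h0 j i, le_abs_self (θ i), abs_nonneg (θ i)]
        _ = _ := by simp
  simp_rw [heq]
  rw [lintegral_const_mul' _ _ ENNReal.ofReal_ne_top,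
    ← ofReal_integral_eq_lintegral_ofReal hint (ae_of_all _ fun _ => (Real.exp_pos _).le),
    ← ENNReal.ofReal_mul (Real.exp_pos _).le, ← ENNReal.ofReal_one]
  refine ENNReal.ofReal_le_ofReal ?_
  have h := mgf_sum_le_of_sum_le_one ham hind ha0 ha1 θ
  simp only [mgf, one_mul] at h
  calc _ ≤ Real.exp (-C) * Real.exp C := by gcongr
    _ = 1 := by rw [← Real.exp_add]; simp

/-- Exponential moment of `∑ᵢ (√Sᵢ - √E Sᵢ)²` for a sum `S` of independent vectors with nonnegative
coordinates of sum at most `1`. -/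
theorem lintegral_exp_sum_sq_sqrt_sub_le (ham : ∀ j, Measurable (a j)) (hind : iIndepFun a P)
    (ha0 : ∀ j, ∀ᵐ ω ∂P, ∀ i, 0 ≤ a j ω i) (ha1 : ∀ j, ∀ᵐ ω ∂P, ∑ i, a j ω i ≤ 1) :
    ∫⁻ ω, ENNReal.ofReal (Real.exp
      ((∑ i, (√(∑ j, a j ω i) - √(∑ j, ∫ ω, a j ω i ∂P)) ^ 2) / 4)) ∂P ≤
      ENNReal.ofReal (Real.exp (4 * Fintype.card ι)) := by
  have hmeas : ∀ j i, Measurable fun ω => a j ω i := fun j i => measurable_pi_iff.1 (ham j) i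
  have hsm : ∀ i, Measurable fun ω => ∑ j, a j ω i := fun i =>
    Finset.measurable_sum _ fun j _ => hmeas j i
  have h := lintegral_prod_le_of_mixture P
    (fun j : ℕ × Bool => ENNReal.ofReal (Real.exp (1 - (j.1 : ℝ) / 4)))
    (fun i j => tilt (∑ j, ∫ ω, a j ω i ∂P) j)
    (fun i t ω => ENNReal.ofReal (Real.exp (t * (∑ j, a j ω i) -
      (∑ j, ∫ ω, a j ω i ∂P) * (Real.exp t - 1))))
    (fun i t => by
      have := hsm i
      fun_prop)
    (fun i ω => ENNReal.ofReal (Real.exp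
      ((√(∑ j, a j ω i) - √(∑ j, ∫ ω, a j ω i ∂P)) ^ 2 / 4)))
    (fun i => by
      have := hsm i
      fun_prop)
    (by
      filter_upwards [ae_all_iff.2 ha0] with ω h0 i
      obtain ⟨j, hj⟩ := exp_sq_le_tilt (a := ∑ j, a j ω i) (μ := ∑ j, ∫ ω, a j ω i ∂P)
        (Finset.sum_nonneg fun j _ => h0 j i)
        (Finset.sum_nonneg fun j _ => integral_nonneg_of_ae
          ((ha0 j).mono fun ω h => h i))
      refine ⟨j, ?_⟩
      rw [← ENNReal.ofReal_mul (Real.exp_pos _).le]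
      exact ENNReal.ofReal_le_ofReal hj)
    (fun t => lintegral_prod_exp_le_one ham hind ha0 ha1 t)
  calc _ = ∫⁻ ω, ∏ i, ENNReal.ofReal (Real.exp
      ((√(∑ j, a j ω i) - √(∑ j, ∫ ω, a j ω i ∂P)) ^ 2 / 4)) ∂P := by
        refine lintegral_congr fun ω => ?_
        rw [← ENNReal.ofReal_prod_of_nonneg fun _ _ => (Real.exp_pos _).le, ← Real.exp_sum,
          Finset.sum_div]
    _ ≤ _ := h
    _ ≤ ENNReal.ofReal (Real.exp 4) ^ Fintype.card ι := by
        gcongr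
        exact tsum_tilt_weight_le
    _ = _ := by
        rw [← ENNReal.ofReal_pow (Real.exp_pos _).le, ← Real.exp_nat_mul, mul_comm]

end Independent

/-! ### The quasi-distance `H` and piecewise constant functions -/

section Deterministic

variable {X : Type*}

lemma SetPartition.eq_of_mem {m : SetPartition X} {I J : Set X} {x : X} (hI : I ∈ m.parts)
    (hJ : J ∈ m.parts) (hxI : x ∈ I) (hxJ : x ∈ J) : I = J := by
  by_contra h
  exact (Set.disjoint_left.1 (m.disjoint hI hJ h)) hxI hxJ

lemma SetPartition.exists_mem (m : SetPartition X) (x : X) : ∃ I ∈ m.parts, x ∈ I := by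
  have h := m.sup_parts
  rw [Finset.sup_id_set_eq_sUnion] at h
  have hx : x ∈ ⋃₀ (m.parts : Set (Set X)) := by rw [h]; trivial
  obtain ⟨I, hI, hxI⟩ := hx
  exact ⟨I, hI, hxI⟩

lemma refine_self (m : SetPartition X) : refine m m = m := by
  classical
  unfold refine
  convert inf_idem m

lemma sum_indicator_of_mem {R : Type*} [AddCommMonoid R] {m : SetPartition X}
    {F : Finset (Set X)} (hF : F ⊆ m.parts) (c : Set X → R) {I : Set X} (hI : I ∈ F) {x : X}
    (hx : x ∈ I) : ∑ J ∈ F, J.indicator (fun _ => c J) x = c I := by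
  rw [Finset.sum_eq_single I, indicator_of_mem hx]
  · intro J hJ hne
    exact indicator_of_notMem
      (fun hxJ => hne (SetPartition.eq_of_mem (hF hJ) (hF hI) hxJ hx)) _
  · exact fun h => (h hI).elim

lemma sum_indicator_of_notMem {R : Type*} [AddCommMonoid R] {m : SetPartition X}
    {F : Finset (Set X)} (hF : F ⊆ m.parts) (c : Set X → R) {I : Set X} (hIm : I ∈ m.parts)
    (hI : I ∉ F) {x : X} (hx : x ∈ I) : ∑ J ∈ F, J.indicator (fun _ => c J) x = 0 := by
  refine Finset.sum_eq_zero fun J hJ => indicator_of_notMem (fun hxJ => hI ?_) _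
  rwa [SetPartition.eq_of_mem hIm (hF hJ) hx hxJ]

lemma exists_part_of_mem_refine {m m' : SetPartition X} {J : Set X}
    (hJ : J ∈ (refine m m').parts) : ∃ I ∈ m.parts, J ⊆ I := by
  obtain ⟨-, I, hI, I', -, rfl⟩ := (mem_refine_parts m m' J).1 hJ
  exact ⟨I, hI, inter_subset_left⟩

lemma inter_eq_empty_or_subset {m m' : SetPartition X} {I J : Set X}
    (hJ : J ∈ (refine m m').parts) (hI : I ∈ m.parts) : J ∩ I = ∅ ∨ J ⊆ I := by
  obtain ⟨I', hI', h⟩ := exists_part_of_mem_refine hJ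
  by_cases hII : I = I'
  · exact Or.inr (hII ▸ h)
  · left
    have := Set.disjoint_left.1 (m.disjoint hI hI' hII)
    ext x
    simp only [mem_inter_iff, mem_empty_iff_false, iff_false, not_and]
    exact fun hx hxI => this hxI (h hx)

variable [MeasurableSpace X]

lemma lintegral_eq_sum_parts {m : SetPartition X} (hm : IsMeasurablePartition m) (μ : Measure X)
    (f : X → ℝ≥0∞) : ∫⁻ x, f x ∂μ = ∑ I ∈ m.parts, ∫⁻ x in I, f x ∂μ := by
  have hu : (⋃ I ∈ m.parts, id I) = univ := by
    refine eq_univ_of_forall fun x => ?_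
    obtain ⟨I, hI, hx⟩ := m.exists_mem x
    exact mem_biUnion hI hx
  have h := lintegral_biUnion_finset (μ := μ) (t := id) m.disjoint (fun I hI => hm I hI) f
  rwa [hu, setLIntegral_univ] at h

lemma measure_eq_sum_parts {m : SetPartition X} (hm : IsMeasurablePartition m) (ρ : Measure X)
    (I : Set X) : ρ I = ∑ J ∈ m.parts, ρ (J ∩ I) := by
  have h := lintegral_eq_sum_parts hm (ρ.restrict I) 1
  simp only [Pi.one_apply, lintegral_one, Measure.restrict_apply_univ] at h
  rw [h]
  refine Finset.sum_congr rfl fun J hJ => ?_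
  rw [Measure.restrict_apply (hm J hJ)]

lemma isMeasurablePartition_refine {m m' : SetPartition X} (hm : IsMeasurablePartition m)
    (hm' : IsMeasurablePartition m') : IsMeasurablePartition (refine m m') := by
  intro A hA
  obtain ⟨-, I, hI, I', hI', rfl⟩ := (mem_refine_parts m m' A).1 hA
  exact (hm I hI).inter (hm' I' hI')

/-! #### Elementary properties of `H²` -/

lemma hellingerSq_comm (μ : Measure X) (f g : X → ℝ≥0) :
    hellingerSq μ f g = hellingerSq μ g f := by
  unfold hellingerSq
  congr with x
  congr 1
  ring

lemma hellingerSq_self (μ : Measure X) (f : X → ℝ≥0) : hellingerSq μ f f = 0 := by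
  simp [hellingerSq]

lemma measurable_hellinger_integrand {f g : X → ℝ≥0} (hf : Measurable f) (hg : Measurable g) :
    Measurable fun x => ENNReal.ofReal ((√(f x : ℝ) - √(g x : ℝ)) ^ 2) := by
  fun_prop

lemma hellingerSq_triangle {μ : Measure X} {f g h : X → ℝ≥0} (hf : Measurable f)
    (hg : Measurable g) (p q : ℝ≥0) (hpq : ∀ x y : ℝ, (x + y) ^ 2 ≤ p * x ^ 2 + q * y ^ 2) :
    hellingerSq μ f h ≤ p * hellingerSq μ f g + q * hellingerSq μ g h := by
  unfold hellingerSq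
  rw [← lintegral_const_mul' _ _ ENNReal.coe_ne_top, ← lintegral_const_mul' _ _ ENNReal.coe_ne_top,
    ← lintegral_add_left ((measurable_hellinger_integrand hf hg).const_mul _)]
  refine lintegral_mono fun x => ?_
  rw [← ENNReal.ofReal_coe_nnreal (p := p), ← ENNReal.ofReal_coe_nnreal (p := q),
    ← ENNReal.ofReal_mul p.coe_nonneg, ← ENNReal.ofReal_mul q.coe_nonneg,
    ← ENNReal.ofReal_add (by positivity) (by positivity)]
  refine ENNReal.ofReal_le_ofReal ?_
  have := hpq (√(f x : ℝ) - √(g x : ℝ)) (√(g x : ℝ) - √(h x : ℝ))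
  rwa [sub_add_sub_cancel] at this

lemma hellingerSq_le_two {μ : Measure X} {f g h : X → ℝ≥0} (hf : Measurable f)
    (hg : Measurable g) :
    hellingerSq μ f h ≤ 2 * hellingerSq μ f g + 2 * hellingerSq μ g h := by
  have := hellingerSq_triangle (μ := μ) (h := h) hf hg 2 2
    (fun x y => by push_cast; nlinarith [sq_nonneg (x - y)])
  exact_mod_cast this

lemma hellingerSq_zero_right (μ : Measure X) (f : X → ℝ≥0) :
    hellingerSq μ f 0 = ∫⁻ x, f x ∂μ := by
  unfold hellingerSq
  congr with x
  simp [Real.sq_sqrt]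

/-- The integrals `∫ (√f - τ)² dν` as a quadratic polynomial in `τ`. -/
lemma exists_lintegral_sqrt_sub_sq (ν : Measure X) [IsFiniteMeasure ν] {f : X → ℝ≥0}
    (hf : Measurable f) (c : ℝ≥0) (h : ∫⁻ x, f x ∂ν = c * ν univ) :
    ∃ b : ℝ, 0 ≤ b ∧ b ≤ √(c : ℝ) * ν.real univ ∧ ∀ τ : ℝ,
      ∫⁻ x, ENNReal.ofReal ((√(f x : ℝ) - τ) ^ 2) ∂ν =
        ENNReal.ofReal (c * ν.real univ - 2 * τ * b + τ ^ 2 * ν.real univ) := by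
  have hfi : Integrable (fun x => (f x : ℝ)) ν := by
    refine ⟨by fun_prop, ?_⟩
    rw [hasFiniteIntegral_iff_ofReal (ae_of_all _ fun x => (f x).coe_nonneg)]
    simp only [ENNReal.ofReal_coe_nnreal, h]
    exact ENNReal.mul_lt_top ENNReal.coe_lt_top (measure_lt_top _ _)
  have hfint : ∫ x, (f x : ℝ) ∂ν = c * ν.real univ := by
    rw [integral_eq_lintegral_of_nonneg_ae (ae_of_all _ fun x => (f x).coe_nonneg) (by fun_prop)]
    simp [h, Measure.real]
  have hsi : Integrable (fun x => √(f x : ℝ)) ν := by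
    refine Integrable.mono' (hfi.add (integrable_const (1 : ℝ))) (by fun_prop)
      (ae_of_all _ fun x => ?_)
    rw [Real.norm_of_nonneg (Real.sqrt_nonneg _)]
    have := Real.sq_sqrt (f x).coe_nonneg
    simp only [Pi.add_apply]
    nlinarith [sq_nonneg (√(f x : ℝ) - 1), Real.sqrt_nonneg (f x : ℝ)]
  set b := ∫ x, √(f x : ℝ) ∂ν
  have hb : 0 ≤ b := integral_nonneg fun x => Real.sqrt_nonneg _
  set M := ν.real univ
  have hM : 0 ≤ M := measureReal_nonneg
  have expand : ∀ (τ : ℝ) x, (√(f x : ℝ) - τ) ^ 2 = (f x : ℝ) - 2 * τ * √(f x : ℝ) + τ ^ 2 := by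
    intro τ x
    have := Real.sq_sqrt (f x).coe_nonneg
    linear_combination this
  have hi1 : ∀ τ : ℝ, Integrable (fun x => (f x : ℝ) - 2 * τ * √(f x : ℝ)) ν := fun τ =>
    hfi.sub (hsi.const_mul _)
  have hint : ∀ τ : ℝ, Integrable (fun x => (√(f x : ℝ) - τ) ^ 2) ν := by
    intro τ
    simp_rw [expand]
    exact (hi1 τ).add (integrable_const _)
  have hval : ∀ τ : ℝ, ∫ x, (√(f x : ℝ) - τ) ^ 2 ∂ν = c * M - 2 * τ * b + τ ^ 2 * M := by
    intro τ
    simp_rw [expand]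
    rw [integral_add (hi1 τ) (integrable_const _), integral_sub hfi (hsi.const_mul _),
      integral_const_mul, integral_const, hfint, smul_eq_mul]
    ring
  refine ⟨b, hb, ?_, fun τ => ?_⟩
  · rcases hM.eq_or_lt with h0 | h0
    · have hν : ν = 0 := by
        have : ν univ = 0 := by
          rcases (ENNReal.toReal_eq_zero_iff _).1 h0.symm with h | h
          · exact h
          · exact absurd h (measure_ne_top _ _)
        exact Measure.measure_univ_eq_zero.1 this
      rw [← h0]
      simp [b, hν]
    -- Cauchy–Schwarz: nonnegativity of the quadratic at its minimiser `b / M`.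
    · have h1 : 0 ≤ c * M - 2 * (b / M) * b + (b / M) ^ 2 * M := by
        rw [← hval]; exact integral_nonneg fun x => sq_nonneg _
      have h2 : c * M - 2 * (b / M) * b + (b / M) ^ 2 * M = (c * M ^ 2 - b ^ 2) / M := by
        field_simp
        ring
      rw [h2] at h1
      have h3 : 0 ≤ c * M ^ 2 - b ^ 2 := by
        by_contra hc
        exact absurd h1 (not_le.2 (div_neg_of_neg_of_pos (not_le.1 hc) h0))
      refine Real.le_sqrt_of_sq_le (y := c * M ^ 2) (by linarith) |>.trans ?_
      rw [Real.sqrt_mul c.coe_nonneg, Real.sqrt_sq hM]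
  · rw [← hval, ofReal_integral_eq_lintegral_ofReal (hint τ) (ae_of_all _ fun x => sq_nonneg _)]

/-- The best constant for `H²` is the squared mean of `√f`, not the mean `c` of `f`; using `c` loses
a factor 2 at most. -/
lemma lintegral_sqrt_sub_sqrt_mean_le (ν : Measure X) [IsFiniteMeasure ν] {f : X → ℝ≥0}
    (hf : Measurable f) (c : ℝ≥0) (h : ∫⁻ x, f x ∂ν = c * ν univ) (t : ℝ≥0) :
    ∫⁻ x, ENNReal.ofReal ((√(f x : ℝ) - √(c : ℝ)) ^ 2) ∂ν ≤
      2 * ∫⁻ x, ENNReal.ofReal ((√(f x : ℝ) - √(t : ℝ)) ^ 2) ∂ν := by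
  obtain ⟨b, hb, hbM, hq⟩ := exists_lintegral_sqrt_sub_sq ν hf c h
  rw [hq, hq, ← ENNReal.ofReal_ofNat, ← ENNReal.ofReal_mul (by norm_num)]
  refine ENNReal.ofReal_le_ofReal ?_
  have hc := Real.sq_sqrt c.coe_nonneg
  have hM : 0 ≤ ν.real univ := measureReal_nonneg
  set M := ν.real univ
  set r := √(c : ℝ)
  have hr : 0 ≤ r := Real.sqrt_nonneg _
  set τ := √(t : ℝ)
  have hτ : 0 ≤ τ := Real.sqrt_nonneg _
  rw [← hc]
  -- The claim reduces to `(2τ - r) b ≤ τ² M`. If `r ≤ 2τ`, use `b ≤ r M` and `(τ - r)² ≥ 0`;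
  -- otherwise the left side is nonpositive.
  rcases le_total r (2 * τ) with h1 | h1
  · nlinarith [mul_le_mul_of_nonneg_right hbM (sub_nonneg.2 h1), mul_nonneg hM (sq_nonneg (r - τ))]
  · nlinarith [mul_nonneg hb (sub_nonneg.2 h1), mul_nonneg hM (sq_nonneg τ)]

lemma const_le_lintegral_sqrt_sub_sqrt (ν : Measure X) [IsFiniteMeasure ν] {f : X → ℝ≥0}
    (hf : Measurable f) (c : ℝ≥0) (h : ∫⁻ x, f x ∂ν = c * ν univ) (t : ℝ≥0) :
    ENNReal.ofReal ((√(c : ℝ) - √(t : ℝ)) ^ 2) * ν univ ≤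
      ∫⁻ x, ENNReal.ofReal ((√(f x : ℝ) - √(t : ℝ)) ^ 2) ∂ν := by
  obtain ⟨b, hb, hbM, hq⟩ := exists_lintegral_sqrt_sub_sq ν hf c h
  rw [hq, ← ENNReal.ofReal_toReal (measure_ne_top ν univ), ← ENNReal.ofReal_mul (sq_nonneg _)]
  refine ENNReal.ofReal_le_ofReal ?_
  change (√(c : ℝ) - √(t : ℝ)) ^ 2 * ν.real univ ≤ _
  have hc := Real.sq_sqrt c.coe_nonneg
  have hτ : 0 ≤ √(t : ℝ) := Real.sqrt_nonneg _
  have e : (√(c : ℝ) - √(t : ℝ)) ^ 2 = c - 2 * √(c : ℝ) * √(t : ℝ) + √(t : ℝ) ^ 2 := by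
    linear_combination hc
  rw [e]
  nlinarith [mul_le_mul_of_nonneg_left hbM hτ]

/-! #### Averages over the elements of a partition -/

/-- A function `g` whose value on `I ∈ F` is the average of `f` and that agrees elsewhere with `t`
satisfies `H²(f, g) ≤ 2 H²(f, t)` if `t` is constant on the elements of `F`. -/
lemma hellingerSq_average_le {m : SetPartition X} (hm : IsMeasurablePartition m)
    {F : Finset (Set X)} {μ : Measure X} (hfin : ∀ I ∈ F, μ I < ∞) {f g t : X → ℝ≥0}
    (hf : Measurable f) (c : Set X → ℝ≥0) (hg : ∀ I ∈ F, ∀ x ∈ I, g x = c I)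
    (hfc : ∀ I ∈ F, ∫⁻ x in I, f x ∂μ = c I * μ I)
    (hgt : ∀ I ∈ m.parts, I ∉ F → ∀ x ∈ I, g x = t x) (b : Set X → ℝ≥0)
    (ht : ∀ I ∈ F, ∀ x ∈ I, t x = b I) : hellingerSq μ f g ≤ 2 * hellingerSq μ f t := by
  unfold hellingerSq
  rw [lintegral_eq_sum_parts hm, lintegral_eq_sum_parts hm, Finset.mul_sum]
  refine Finset.sum_le_sum fun I hI => ?_
  by_cases hIF : I ∈ F
  · have : IsFiniteMeasure (μ.restrict I) := ⟨by simpa using hfin I hIF⟩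
    have h := lintegral_sqrt_sub_sqrt_mean_le (μ.restrict I) hf (c I)
      (by simpa using hfc I hIF) (b I)
    rw [setLIntegral_congr_fun (g := fun x => ENNReal.ofReal ((√(f x : ℝ) - √(c I : ℝ)) ^ 2))
      (hm I hI) (fun x hx => by simp only [hg I hIF x hx]),
      setLIntegral_congr_fun (f := fun x => ENNReal.ofReal ((√(f x : ℝ) - √(t x : ℝ)) ^ 2))
      (g := fun x => ENNReal.ofReal ((√(f x : ℝ) - √(b I : ℝ)) ^ 2))
      (hm I hI) (fun x hx => by simp only [ht I hIF x hx])]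
    exact h
  · rw [setLIntegral_congr_fun (g := fun x => ENNReal.ofReal ((√(f x : ℝ) - √(t x : ℝ)) ^ 2))
      (hm I hI) (fun x hx => by simp only [hgt I hI hIF x hx])]
    exact le_mul_of_one_le_left zero_le (by norm_num)

/-- Averaging does not increase the distance to functions that are constant on the elements of
the partition. -/
lemma hellingerSq_average_left_le {m : SetPartition X} (hm : IsMeasurablePartition m)
    {F : Finset (Set X)} {μ : Measure X} (hfin : ∀ I ∈ F, μ I < ∞) {f g t : X → ℝ≥0}
    (hf : Measurable f) (c : Set X → ℝ≥0) (hg : ∀ I ∈ F, ∀ x ∈ I, g x = c I)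
    (hfc : ∀ I ∈ F, ∫⁻ x in I, f x ∂μ = c I * μ I)
    (hgt : ∀ I ∈ m.parts, I ∉ F → ∀ x ∈ I, g x = t x) (b : Set X → ℝ≥0)
    (ht : ∀ I ∈ F, ∀ x ∈ I, t x = b I) : hellingerSq μ g t ≤ hellingerSq μ f t := by
  unfold hellingerSq
  rw [lintegral_eq_sum_parts hm, lintegral_eq_sum_parts hm]
  refine Finset.sum_le_sum fun I hI => ?_
  by_cases hIF : I ∈ F
  · have : IsFiniteMeasure (μ.restrict I) := ⟨by simpa using hfin I hIF⟩
    have h := const_le_lintegral_sqrt_sub_sqrt (μ.restrict I) hf (c I)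
      (by simpa using hfc I hIF) (b I)
    rw [setLIntegral_congr_fun (g := fun x => ENNReal.ofReal ((√(c I : ℝ) - √(b I : ℝ)) ^ 2))
      (hm I hI) (fun x hx => by simp only [hg I hIF x hx, ht I hIF x hx]),
      setLIntegral_congr_fun (f := fun x => ENNReal.ofReal ((√(f x : ℝ) - √(t x : ℝ)) ^ 2))
      (g := fun x => ENNReal.ofReal ((√(f x : ℝ) - √(b I : ℝ)) ^ 2))
      (hm I hI) (fun x hx => by simp only [ht I hIF x hx]), setLIntegral_const]
    simpa using h
  · rw [setLIntegral_congr_fun (g := fun x => 0)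
      (hm I hI) (fun x hx => by simp [hgt I hI hIF x hx])]
    simp

/-- The piecewise constant function with value `ρ(I) / μ(I)` on `I ∈ F`. -/
def ratioFun (F : Finset (Set X)) (ρ μ : Measure X) (x : X) : ℝ≥0 :=
  ∑ I ∈ F, I.indicator (fun _ => (ρ I / μ I).toNNReal) x

lemma measurable_ratioFun {F : Finset (Set X)} (hF : ∀ I ∈ F, MeasurableSet I)
    (ρ μ : Measure X) : Measurable (ratioFun F ρ μ) :=
  Finset.measurable_sum _ fun I hI => measurable_const.indicator (hF I hI)

lemma toNNReal_div_mul_cancel {a b : ℝ≥0∞} (ha : a ≠ ∞) (hb : b ≠ ∞) (h : b = 0 → a = 0) :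
    ((a / b).toNNReal : ℝ≥0∞) * b = a := by
  by_cases hb0 : b = 0
  · simp [hb0, h hb0]
  · rw [ENNReal.coe_toNNReal (ENNReal.div_ne_top ha hb0), ENNReal.div_mul_cancel hb0 hb]

lemma setLIntegral_ratioFun {F : Finset (Set X)} (hF : ∀ I ∈ F, MeasurableSet I)
    (ρ μ : Measure X) (I : Set X) :
    ∫⁻ x in I, ratioFun F ρ μ x ∂μ = ∑ J ∈ F, ((ρ J / μ J).toNNReal : ℝ≥0∞) * μ (J ∩ I) := by
  have : ∀ x, (ratioFun F ρ μ x : ℝ≥0∞) =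
      ∑ J ∈ F, J.indicator (fun _ => ((ρ J / μ J).toNNReal : ℝ≥0∞)) x := by
    intro x
    unfold ratioFun
    push_cast
    refine Finset.sum_congr rfl fun J _ => ?_
    by_cases hx : x ∈ J <;> simp [hx]
  simp_rw [this]
  rw [lintegral_finsetSum' _ fun J hJ => (measurable_const.indicator (hF J hJ)).aemeasurable]
  refine Finset.sum_congr rfl fun J hJ => ?_
  rw [lintegral_indicator (hF J hJ), setLIntegral_const, Measure.restrict_apply (hF J hJ)]

lemma lintegral_ratioFun_lt_top {F : Finset (Set X)} (hF : ∀ I ∈ F, MeasurableSet I)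
    {ρ μ : Measure X} (hfin : ∀ I ∈ F, μ I < ∞) : ∫⁻ x, ratioFun F ρ μ x ∂μ < ∞ := by
  rw [← setLIntegral_univ, setLIntegral_ratioFun hF]
  refine ENNReal.sum_lt_top.2 fun J hJ => ENNReal.mul_lt_top ENNReal.coe_lt_top ?_
  rw [inter_univ]
  exact hfin J hJ

lemma hellingerSq_ratioFun_ne_top {F F' : Finset (Set X)} (hF : ∀ I ∈ F, MeasurableSet I)
    (hF' : ∀ I ∈ F', MeasurableSet I) {ρ μ : Measure X} (hfin : ∀ I ∈ F, μ I < ∞)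
    (hfin' : ∀ I ∈ F', μ I < ∞) : hellingerSq μ (ratioFun F ρ μ) (ratioFun F' ρ μ) ≠ ∞ := by
  have h := hellingerSq_le_two (μ := μ) (h := ratioFun F' ρ μ) (measurable_ratioFun hF ρ μ)
    (g := 0) measurable_const
  rw [hellingerSq_comm μ 0, hellingerSq_zero_right, hellingerSq_zero_right] at h
  refine (h.trans_lt ?_).ne
  exact ENNReal.add_lt_top.2 ⟨ENNReal.mul_lt_top (by simp) (lintegral_ratioFun_lt_top hF hfin),
    ENNReal.mul_lt_top (by simp) (lintegral_ratioFun_lt_top hF' hfin')⟩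

/-- The averages of the histogram of a refinement are those of the coarser histogram. -/
lemma setLIntegral_ratioFun_of_refines {V : SetPartition X} (hV : IsMeasurablePartition V)
    {F : Finset (Set X)} (hFV : F ⊆ V.parts) {ρ μ : Measure X} (hρ : ρ univ < ∞)
    (hfin : ∀ J ∈ F, μ J < ∞) (hac : ∀ J ∈ F, μ J = 0 → ρ J = 0) {I : Set X} (hI : μ I < ∞)
    (hIac : μ I = 0 → ρ I = 0)
    (hdis : ∀ J ∈ V.parts, J ∩ I = ∅ ∨ (J ⊆ I ∧ J ∈ F)) :
    ∫⁻ x in I, ratioFun F ρ μ x ∂μ = ((ρ I / μ I).toNNReal : ℝ≥0∞) * μ I := by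
  have hρ' : ∀ A, ρ A ≠ ∞ := fun A => ((measure_mono (subset_univ A)).trans_lt hρ).ne
  rw [toNNReal_div_mul_cancel (hρ' I) hI.ne hIac, measure_eq_sum_parts hV,
    setLIntegral_ratioFun fun J hJ => hV J (hFV hJ)]
  rw [← Finset.sum_subset hFV]
  · refine Finset.sum_congr rfl fun J hJ => ?_
    rcases hdis J (hFV hJ) with h | ⟨h, -⟩
    · simp [h]
    · rw [inter_eq_left.2 h, toNNReal_div_mul_cancel (hρ' J) (hfin J hJ).ne (hac J hJ)]
  · intro J hJ hJF
    rcases hdis J hJ with h | ⟨-, h⟩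
    · simp [h]
    · exact (hJF h).elim

/-- On a cell, `μ(J) (√(ρ(J)/μ(J)) - √(ρ'(J)/μ(J)))²` no longer depends on `μ(J)`. Only an
inequality holds because cells with `μ(J) = 0` contribute nothing on the left. -/
lemma hellingerSq_ratioFun_le_sum {V : SetPartition X} (hV : IsMeasurablePartition V)
    {F : Finset (Set X)} (hFV : F ⊆ V.parts) {ρ ρ' μ : Measure X}
    (hfin : ∀ J ∈ F, μ J < ∞) :
    hellingerSq μ (ratioFun F ρ μ) (ratioFun F ρ' μ) ≤
      ∑ J ∈ F, ENNReal.ofReal ((√(ρ.real J) - √(ρ'.real J)) ^ 2) := by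
  unfold hellingerSq
  rw [lintegral_eq_sum_parts hV, ← Finset.sum_subset hFV]
  · refine Finset.sum_le_sum fun J hJ => ?_
    rw [setLIntegral_congr_fun (g := fun x => ENNReal.ofReal
      ((√((ρ J / μ J).toNNReal : ℝ) - √((ρ' J / μ J).toNNReal : ℝ)) ^ 2)) (hV J (hFV hJ))
      (fun x hx => by simp only [ratioFun, sum_indicator_of_mem hFV _ hJ hx]), setLIntegral_const]
    by_cases h0 : μ J = 0
    · simp [h0]
    rw [← ENNReal.ofReal_toReal (hfin J hJ).ne, ← ENNReal.ofReal_mul (sq_nonneg _)]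
    refine ENNReal.ofReal_le_ofReal (le_of_eq ?_)
    have hpos : 0 < (μ J).toReal := ENNReal.toReal_pos h0 (hfin J hJ).ne
    have e : ∀ a : ℝ≥0∞, ((a / ENNReal.ofReal (μ J).toReal).toNNReal : ℝ) =
        a.toReal / (μ J).toReal := by
      intro a
      rw [ENNReal.ofReal_toReal (hfin J hJ).ne]
      exact ENNReal.toReal_div _ _
    rw [e, e, Real.sqrt_div' _ hpos.le, Real.sqrt_div' _ hpos.le, ← sub_div, div_pow,
      Real.sq_sqrt hpos.le, div_mul_cancel₀ _ hpos.ne']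
    rfl
  · intro J hJ hJF
    rw [setLIntegral_congr_fun (g := fun x => 0) (hV J hJ)
      (fun x hx => by simp only [ratioFun, sum_indicator_of_notMem hFV _ hJ hJF hx]; simp)]
    simp

lemma setLIntegral_eq_toNNReal_div_mul {μ : Measure X} {s : X → ℝ≥0}
    (hs : (μ.withDensity fun x => (s x : ℝ≥0∞)) univ < ∞)
    {I : Set X} (hI : MeasurableSet I) (hfin : μ I < ∞) :
    ∫⁻ x in I, s x ∂μ =
      ((μ.withDensity fun x => (s x : ℝ≥0∞)) I / μ I).toNNReal * μ I := by
  rw [toNNReal_div_mul_cancel ((measure_mono (subset_univ I)).trans_lt hs).ne hfin.ne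
    (fun h => withDensity_absolutelyContinuous _ _ h), withDensity_apply _ hI]

/-- The square roots of integrals are closer than the square roots of the integrands. -/
lemma sq_sqrt_integral_sub_le (ν : Measure X) {f g : X → ℝ} (hf : Integrable f ν)
    (hg : Integrable g ν) (hf0 : ∀ x, 0 ≤ f x) (hg0 : ∀ x, 0 ≤ g x) :
    ENNReal.ofReal ((√(∫ x, f x ∂ν) - √(∫ x, g x ∂ν)) ^ 2) ≤
      ∫⁻ x, ENNReal.ofReal ((√(f x) - √(g x)) ^ 2) ∂ν := by
  have hfs : ∀ x, √(f x) ^ 2 = f x := fun x => Real.sq_sqrt (hf0 x)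
  have hgs : ∀ x, √(g x) ^ 2 = g x := fun x => Real.sq_sqrt (hg0 x)
  have hfm : AEStronglyMeasurable (fun x => √(f x)) ν :=
    (Real.continuous_sqrt.comp_aestronglyMeasurable hf.1)
  have hgm : AEStronglyMeasurable (fun x => √(g x)) ν :=
    (Real.continuous_sqrt.comp_aestronglyMeasurable hg.1)
  have hfg : Integrable (fun x => √(f x) * √(g x)) ν := by
    refine Integrable.mono' (hf.add hg) (hfm.mul hgm) (ae_of_all _ fun x => ?_)
    rw [Real.norm_of_nonneg (by positivity)]
    simp only [Pi.add_apply]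
    nlinarith [hfs x, hgs x, sq_nonneg (√(f x) - √(g x)), hf0 x, hg0 x]
  set A := ∫ x, f x ∂ν
  set B := ∫ x, g x ∂ν
  set C := ∫ x, √(f x) * √(g x) ∂ν
  have hA : 0 ≤ A := integral_nonneg hf0
  have hB : 0 ≤ B := integral_nonneg hg0
  have expand : ∀ (r : ℝ) x, (r * √(f x) - √(g x)) ^ 2 =
      (r * r) * f x - (2 * r) * (√(f x) * √(g x)) + g x := by
    intro r x
    linear_combination r * r * hfs x + hgs x
  have hi1 : ∀ r : ℝ, Integrable (fun x => (r * r) * f x - (2 * r) * (√(f x) * √(g x))) ν :=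
    fun r => (hf.const_mul _).sub (hfg.const_mul _)
  have hi : ∀ r : ℝ, Integrable (fun x => (r * √(f x) - √(g x)) ^ 2) ν := by
    intro r
    simp_rw [expand]
    exact (hi1 r).add hg
  have hq : ∀ r : ℝ, ∫ x, (r * √(f x) - √(g x)) ^ 2 ∂ν = A * (r * r) + (-2 * C) * r + B := by
    intro r
    simp_rw [expand]
    rw [integral_add (hi1 r) hg, integral_sub (hf.const_mul _) (hfg.const_mul _),
      integral_const_mul, integral_const_mul]
    ring
  -- Cauchy–Schwarz, `C ≤ √A √B`, read off the discriminant of a nonnegative quadratic.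
  have hd : discrim A (-2 * C) B ≤ 0 := discrim_le_zero fun r => by
    rw [← hq]
    exact integral_nonneg fun x => sq_nonneg _
  have hC : C ≤ √A * √B := by
    rw [← Real.sqrt_mul hA]
    refine Real.le_sqrt_of_sq_le ?_
    unfold discrim at hd
    nlinarith
  have h1 : (∫⁻ x, ENNReal.ofReal ((√(f x) - √(g x)) ^ 2) ∂ν) =
      ENNReal.ofReal (∫ x, (1 * √(f x) - √(g x)) ^ 2 ∂ν) := by
    rw [ofReal_integral_eq_lintegral_ofReal (hi 1) (ae_of_all _ fun x => sq_nonneg _)]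
    simp only [one_mul]
  rw [h1, hq]
  refine ENNReal.ofReal_le_ofReal ?_
  nlinarith [Real.sq_sqrt hA, Real.sq_sqrt hB]

end Deterministic

/-! ### The selection procedure for one realization -/

section Selection

variable {X Ω : Type*} [MeasurableSpace X] [MeasurableSpace Ω] {P : Measure Ω}
  {N M : Ω → Measure X} {s : X → ℝ≥0} {ω : Ω}

lemma finiteParts_subset (m : SetPartition X) : finiteParts P M m ⊆ m.parts := by
  classical
  unfold finiteParts
  exact Finset.filter_subset _ _

lemma mem_finiteParts {m : SetPartition X} {I : Set X} :
    I ∈ finiteParts P M m ↔ I ∈ m.parts ∧ ∫⁻ ω, M ω I ∂P < ∞ := by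
  classical
  unfold finiteParts
  exact Finset.mem_filter

lemma mem_finiteParts_of_subset {m V : SetPartition X} {I J : Set X}
    (hI : I ∈ finiteParts P M m) (hJ : J ∈ V.parts) (hJI : J ⊆ I) : J ∈ finiteParts P M V :=
  mem_finiteParts.2 ⟨hJ, (lintegral_mono fun _ => measure_mono hJI).trans_lt
    (mem_finiteParts.1 hI).2⟩

/-- The piecewise constant approximation of `s` on the partition `m`, with value
`∫_I s dM / M(I)` on `I`. -/
def meanApprox (P : Measure Ω) (M : Ω → Measure X) (s : X → ℝ≥0) (m : SetPartition X) (ω : Ω) :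
    X → ℝ≥0 :=
  ratioFun (finiteParts P M m) ((M ω).withDensity fun x => (s x : ℝ≥0∞)) (M ω)

/-- The realization `ω` is regular for the partition `m`. -/
structure IsRegularAt (P : Measure Ω) (N M : Ω → Measure X) (m : SetPartition X) (ω : Ω) :
    Prop where
  finite : ∀ I ∈ finiteParts P M m, M ω I < ∞
  ac : ∀ I ∈ finiteParts P M m, M ω I = 0 → N ω I = 0

lemma exists_coeff_of_mem_model {m : SetPartition X} {t : X → Ω → ℝ≥0} (ht : t ∈ model P M m)
    (ω : Ω) : ∃ b : Set X → ℝ≥0, (∀ I ∈ finiteParts P M m, ∀ x ∈ I, t x ω = b I) ∧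
      ∀ I ∈ m.parts, I ∉ finiteParts P M m → ∀ x ∈ I, t x ω = 0 := by
  obtain ⟨⟨a, ha⟩, -⟩ := ht
  refine ⟨fun I => (a I ω).toNNReal, fun I hI x hx => ?_, fun I hIm hI x hx => ?_⟩
  · have := ha x ω
    rw [sum_indicator_of_mem (finiteParts_subset m) (fun I => a I ω) hI hx] at this
    simp only [← this, Real.toNNReal_coe]
  · have := ha x ω
    rw [sum_indicator_of_notMem (finiteParts_subset m) (fun I => a I ω) hIm hI hx] at this
    exact_mod_cast this

/-! ### Projection bounds for the histograms and for the means of `s`. -/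

section Bounds

variable {m m' : SetPartition X} {t : X → Ω → ℝ≥0}

lemma measurable_histEst (hm : IsMeasurablePartition m) : Measurable (histEst P N M m ω) :=
  measurable_ratioFun (fun I hI => hm I (finiteParts_subset m hI)) (N ω) (M ω)

lemma measurable_meanApprox (hm : IsMeasurablePartition m) :
    Measurable (meanApprox P M s m ω) :=
  measurable_ratioFun (fun I hI => hm I (finiteParts_subset m hI)) _ (M ω)

/-- Additivity of `N` makes `ŝ_m` the cellwise average of `ŝ_V`; regularity is what gives `ŝ_V` the
mass `N(J)` even on cells with `M(J) = 0`. -/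
lemma hellingerSq_histEst_refine_le (hm : IsMeasurablePartition m)
    (hm' : IsMeasurablePartition m') (hN : N ω univ < ∞) (hr : IsRegularAt P N M m ω)
    (hr' : IsRegularAt P N M (refine m m') ω) (ht : t ∈ model P M m) :
    hellingerSq (M ω) (histEst P N M (refine m m') ω) (histEst P N M m ω) ≤
      2 * hellingerSq (M ω) (histEst P N M (refine m m') ω) (fun x => t x ω) := by
  have hV := isMeasurablePartition_refine hm hm'
  obtain ⟨b, hb, hb0⟩ := exists_coeff_of_mem_model ht ω
  refine hellingerSq_average_le hm hr.finite (measurable_histEst hV)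
    (fun I => (N ω I / M ω I).toNNReal)
    (fun I hI x hx => sum_indicator_of_mem (finiteParts_subset m) _ hI hx)
    (fun I hI => ?_) (fun I hIm hI x hx => ?_) b hb
  · refine setLIntegral_ratioFun_of_refines hV (finiteParts_subset _) hN hr'.finite hr'.ac
      (hr.finite I hI) (hr.ac I hI) fun J hJ => ?_
    exact (inter_eq_empty_or_subset hJ (finiteParts_subset m hI)).imp_right
      fun h => ⟨h, mem_finiteParts_of_subset hI hJ h⟩
  · rw [hb0 I hIm hI x hx]
    exact sum_indicator_of_notMem (finiteParts_subset m) _ hIm hI hx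

/-- An element of `S_m` is also constant on the cells of the refinement, so averaging `s` over these
cells brings it no further from `t`. -/
lemma hellingerSq_meanApprox_refine_le (hsm : Measurable s) (hm : IsMeasurablePartition m)
    (hm' : IsMeasurablePartition m')
    (hs : ((M ω).withDensity fun x => (s x : ℝ≥0∞)) univ < ∞)
    (hr' : IsRegularAt P N M (refine m m') ω) (ht : t ∈ model P M m) :
    hellingerSq (M ω) (meanApprox P M s (refine m m') ω) (fun x => t x ω) ≤
      hellingerSq (M ω) s (fun x => t x ω) := by
  have hV := isMeasurablePartition_refine hm hm'
  obtain ⟨b, hb, hb0⟩ := exists_coeff_of_mem_model ht ω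
  have hex : ∀ J ∈ (refine m m').parts, ∃ c : ℝ≥0, (∀ x ∈ J, t x ω = c) ∧
      (J ∉ finiteParts P M (refine m m') → c = 0) := by
    intro J hJ
    obtain ⟨I, hI, hJI⟩ := exists_part_of_mem_refine hJ
    by_cases hIF : I ∈ finiteParts P M m
    · exact ⟨b I, fun x hx => hb I hIF x (hJI hx),
        fun h => (h (mem_finiteParts_of_subset hIF hJ hJI)).elim⟩
    · exact ⟨0, fun x hx => hb0 I hI hIF x (hJI hx), fun _ => rfl⟩
  choose! c hc hc0 using hex
  refine hellingerSq_average_left_le hV hr'.finite hsm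
    (fun I => (((M ω).withDensity fun x => (s x : ℝ≥0∞)) I / M ω I).toNNReal)
    (fun I hI x hx => sum_indicator_of_mem (finiteParts_subset _) _ hI hx)
    (fun I hI => setLIntegral_eq_toNNReal_div_mul hs (hV I (finiteParts_subset _ hI))
      (hr'.finite I hI)) (fun I hIm hI x hx => ?_) c
    (fun I hI => hc I (finiteParts_subset _ hI))
  rw [hc I hIm x hx, hc0 I hIm hI]
  exact sum_indicator_of_notMem (finiteParts_subset _) _ hIm hI hx

lemma hellingerSq_meanApprox_le (hsm : Measurable s) (hm : IsMeasurablePartition m)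
    (hs : ((M ω).withDensity fun x => (s x : ℝ≥0∞)) univ < ∞)
    (hr : IsRegularAt P N M m ω) (ht : t ∈ model P M m) :
    hellingerSq (M ω) s (meanApprox P M s m ω) ≤ 2 * hellingerSq (M ω) s (fun x => t x ω) := by
  obtain ⟨b, hb, hb0⟩ := exists_coeff_of_mem_model ht ω
  refine hellingerSq_average_le hm hr.finite hsm
    (fun I => (((M ω).withDensity fun x => (s x : ℝ≥0∞)) I / M ω I).toNNReal)
    (fun I hI x hx => sum_indicator_of_mem (finiteParts_subset _) _ hI hx)
    (fun I hI => setLIntegral_eq_toNNReal_div_mul hs (hm I (finiteParts_subset _ hI))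
      (hr.finite I hI)) (fun I hIm hI x hx => ?_) b hb
  rw [hb0 I hIm hI x hx]
  exact sum_indicator_of_notMem (finiteParts_subset m) _ hIm hI hx

end Bounds

/-- If the test between `m` and `m'` may reject `m`, then
`H²(ŝ_{m'}, ŝ_V) + 16 pen m' ≤ H²(ŝ_m, ŝ_V) + 16 pen m` with `V = m ∨ m'`. -/
lemma add_pen_le_of_testStat_nonneg {𝓜 : Set (SetPartition X)} {pen : 𝓜 → ℝ≥0} {m m' : 𝓜}
    (hm : IsMeasurablePartition m.1) (hm' : IsMeasurablePartition m'.1)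
    (hr : IsRegularAt P N M m.1 ω) (hr' : IsRegularAt P N M m'.1 ω)
    (hV : IsRegularAt P N M (refine m.1 m'.1) ω) (hT : 0 ≤ testStat P N M 𝓜 pen ω m m') :
    hellingerSq (M ω) (histEst P N M m' ω) (histEst P N M (refine m.1 m'.1) ω) + 16 * pen m' ≤
      hellingerSq (M ω) (histEst P N M m ω) (histEst P N M (refine m.1 m'.1) ω) + 16 * pen m := by
  have hVm := isMeasurablePartition_refine hm hm'
  have f1 : hellingerSq (M ω) (histEst P N M m ω) (histEst P N M (refine m.1 m'.1) ω) ≠ ∞ :=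
    hellingerSq_ratioFun_ne_top (fun I hI => hm I (finiteParts_subset _ hI))
      (fun I hI => hVm I (finiteParts_subset _ hI)) hr.finite hV.finite
  have f2 : hellingerSq (M ω) (histEst P N M m' ω) (histEst P N M (refine m.1 m'.1) ω) ≠ ∞ :=
    hellingerSq_ratioFun_ne_top (fun I hI => hm' I (finiteParts_subset _ hI))
      (fun I hI => hVm I (finiteParts_subset _ hI)) hr'.finite hV.finite
  unfold testStat at hT
  set A := hellingerSq (M ω) (histEst P N M m ω) (histEst P N M (refine m.1 m'.1) ω)
  set B := hellingerSq (M ω) (histEst P N M m' ω) (histEst P N M (refine m.1 m'.1) ω)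
  have g : ∀ p : ℝ≥0, (16 * p : ℝ≥0∞) = ((16 * p : ℝ≥0) : ℝ≥0∞) := fun p => by push_cast; rfl
  rw [← ENNReal.toReal_le_toReal (by rw [g]; finiteness) (by rw [g]; finiteness),
    ENNReal.toReal_add f2 (by rw [g]; finiteness), ENNReal.toReal_add f1 (by rw [g]; finiteness),
    g, g, ENNReal.coe_toReal, ENNReal.coe_toReal]
  push_cast
  linarith

/-! ### Oracle inequality at a fixed realization. -/

section Oracle

variable {𝓜 : Set (SetPartition X)} {pen : 𝓜 → ℝ≥0} {U : ℝ≥0∞}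

/-- The passage through the refinement costs `32 pen m'`. The factor 16 in the test statistic is
what cancels it, leaving a bound that is uniform over the models preferred to `m`. -/
lemma hellingerSq_le_of_rejected (hsm : Measurable s) (h𝓜 : ∀ m ∈ 𝓜, IsMeasurablePartition m)
    (hN : N ω univ < ∞) (hs : ((M ω).withDensity fun x => (s x : ℝ≥0∞)) univ < ∞)
    (hr : ∀ m ∈ 𝓜, ∀ m' ∈ 𝓜, IsRegularAt P N M (refine m m') ω)
    (hU : ∀ m m' : 𝓜, hellingerSq (M ω) (histEst P N M (refine m.1 m'.1) ω)
      (meanApprox P M s (refine m.1 m'.1) ω) ≤ 2 * (pen m + pen m') + U)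
    {m m' : 𝓜} {t : X → Ω → ℝ≥0} (ht : t ∈ model P M m.1)
    (hT : 0 ≤ testStat P N M 𝓜 pen ω m m') :
    hellingerSq (M ω) (histEst P N M m ω) (histEst P N M m' ω) ≤
      16 * hellingerSq (M ω) s (fun x => t x ω) + 64 * pen m + 16 * U := by
  have hm := h𝓜 m m.2
  have hm' := h𝓜 m' m'.2
  have hrm : IsRegularAt P N M m.1 ω := by simpa only [refine_self] using hr m m.2 m m.2
  have hrm' : IsRegularAt P N M m'.1 ω := by simpa only [refine_self] using hr m' m'.2 m' m'.2
  have hrV := hr m m.2 m' m'.2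
  have hV := isMeasurablePartition_refine hm hm'
  have h1 := add_pen_le_of_testStat_nonneg hm hm' hrm hrm' hrV hT
  have h2 := hellingerSq_histEst_refine_le hm hm' hN hrm hrV ht
  have h3 := hellingerSq_meanApprox_refine_le hsm hm hm' hs hrV ht
  have h4 := hellingerSq_le_two (μ := M ω) (h := fun x => t x ω)
    (measurable_histEst (P := P) (N := N) (M := M) (ω := ω) hV)
    (measurable_meanApprox (P := P) (M := M) (s := s) (ω := ω) hV)
  have h5 := hU m m'
  have h6 := hellingerSq_le_two (μ := M ω) (h := histEst P N M m' ω)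
    (measurable_histEst (P := P) (N := N) (M := M) (ω := ω) hm)
    (measurable_histEst (P := P) (N := N) (M := M) (ω := ω) hV)
  rw [hellingerSq_comm (M ω) (histEst P N M (refine m.1 m'.1) ω) (histEst P N M m' ω)] at h6
  rw [hellingerSq_comm (M ω) (histEst P N M m ω)
    (histEst P N M (refine m.1 m'.1) ω)] at h1 h6
  set A := hellingerSq (M ω) (histEst P N M (refine m.1 m'.1) ω) (histEst P N M m ω)
  set B := hellingerSq (M ω) (histEst P N M m' ω) (histEst P N M (refine m.1 m'.1) ω)
  set h := hellingerSq (M ω) s (fun x => t x ω)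
  have hA : A ≤ 2 * (2 * (2 * (pen m + pen m') + U) + 2 * h) :=
    h2.trans (mul_le_mul_right (h4.trans (add_le_add (mul_le_mul_right h5 _)
      (mul_le_mul_right h3 _))) _)
  -- The cancellation of `32 pen m'` is written additively, to avoid truncated subtraction.
  refine (ENNReal.add_le_add_iff_right (a := 32 * (pen m' : ℝ≥0∞)) (by finiteness)).1 ?_
  calc _ ≤ (2 * A + 2 * B) + 32 * (pen m' : ℝ≥0∞) := by
        gcongr
    _ = 2 * A + 2 * (B + 16 * pen m') := by ring
    _ ≤ 2 * A + 2 * (A + 16 * pen m) := by gcongr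
    _ = 4 * A + 32 * pen m := by ring
    _ ≤ 4 * (2 * (2 * (2 * (pen m + pen m') + U) + 2 * h)) + 32 * pen m := by gcongr
    _ = _ := by ring

/-- The oracle inequality for one realization. -/
theorem hellingerSq_selected_le (hsm : Measurable s) (h𝓜 : ∀ m ∈ 𝓜, IsMeasurablePartition m)
    (hN : N ω univ < ∞) (hs : ((M ω).withDensity fun x => (s x : ℝ≥0∞)) univ < ∞)
    (hr : ∀ m ∈ 𝓜, ∀ m' ∈ 𝓜, IsRegularAt P N M (refine m m') ω)
    (hU : ∀ m m' : 𝓜, hellingerSq (M ω) (histEst P N M (refine m.1 m'.1) ω)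
      (meanApprox P M s (refine m.1 m'.1) ω) ≤ 2 * (pen m + pen m') + U)
    {ε : ℝ} {mhat : 𝓜} (hsel : IsSelected P N M 𝓜 pen ε ω mhat) (m : 𝓜)
    {t : X → Ω → ℝ≥0} (ht : t ∈ model P M m.1) :
    hellingerSq (M ω) (histEst P N M mhat ω) s ≤
      54 * hellingerSq (M ω) s (fun x => t x ω) + 204 * pen m + 51 * U + ENNReal.ofReal ε := by
  obtain ⟨rej, hrej, hdisc⟩ := hsel
  set h := hellingerSq (M ω) s (fun x => t x ω)
  have hm := h𝓜 m m.2
  have hrm : IsRegularAt P N M m.1 ω := by simpa only [refine_self] using hr m m.2 m m.2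
  have hD : discrepancy P N M 𝓜 rej ω m ≤ 16 * h + 64 * pen m + 16 * U := by
    refine iSup₂_le fun m' hm' => ?_
    refine hellingerSq_le_of_rejected hsm h𝓜 hN hs hr hU ht ?_
    by_contra hc
    exact hrej.accepts_of_neg m m' hm'.1.symm (not_le.1 hc) hm'.2
  have h1 : hellingerSq (M ω) (histEst P N M mhat ω) (histEst P N M m ω) ≤
      16 * h + 64 * pen m + 16 * U + ENNReal.ofReal (ε / 3) := by
    -- The test between `m` and `mhat` rejects one of them: if `m`, the distance is at most `𝓓(m)`;
    -- if `mhat`, it is at most `𝓓(mhat) ≤ 𝓓(m) + ε / 3`.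
    by_cases heq : m = mhat
    · rw [heq, hellingerSq_self]; exact zero_le
    by_cases hrj : rej m mhat
    · rw [hellingerSq_comm]
      refine le_trans ?_ (hD.trans le_self_add)
      exact le_iSup₂ (f := fun (m' : 𝓜) (_ : m' ∈ {m' : 𝓜 | m' ≠ m ∧ rej m m'}) =>
        hellingerSq (M ω) (histEst P N M m ω) (histEst P N M m' ω)) mhat ⟨Ne.symm heq, hrj⟩
    · have hrj' : rej mhat m := by
        by_contra hc
        exact hrj ((hrej.decides_one m mhat heq).2 hc)
      refine le_trans ?_ (hdisc.trans (add_le_add_left ((iInf_le _ m).trans hD) _))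
      exact le_iSup₂ (f := fun (m' : 𝓜) (_ : m' ∈ {m' : 𝓜 | m' ≠ mhat ∧ rej mhat m'}) =>
        hellingerSq (M ω) (histEst P N M mhat ω) (histEst P N M m' ω)) m ⟨heq, hrj'⟩
  have h2 : hellingerSq (M ω) (histEst P N M m ω) s ≤
      2 * (2 * (pen m + pen m) + U) + 2 * (2 * h) := by
    have h3 := hellingerSq_le_two (μ := M ω) (h := s)
      (measurable_histEst (P := P) (N := N) (M := M) (ω := ω) hm)
      (measurable_meanApprox (P := P) (M := M) (s := s) (ω := ω) hm)
    have h4 := hU m m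
    rw [refine_self] at h4
    have h5 := hellingerSq_meanApprox_le hsm hm hs hrm ht
    rw [hellingerSq_comm] at h5
    exact h3.trans (by gcongr)
  -- The unequal weights `3` and `3 / 2` are chosen so that `ε / 3` becomes exactly `ε`.
  have h3 := hellingerSq_triangle (μ := M ω) (h := s)
    (measurable_histEst (P := P) (N := N) (M := M) (ω := ω) (h𝓜 mhat mhat.2))
    (measurable_histEst (P := P) (N := N) (M := M) (ω := ω) hm) 3 (3 / 2)
    (fun x y => by push_cast; nlinarith [sq_nonneg (2 * x - y)])
  have e1 : (3 / 2 : ℝ≥0∞) * 2 = 3 := ENNReal.div_mul_cancel (by simp) (by simp)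
  have e2 : 3 * ENNReal.ofReal (ε / 3) = ENNReal.ofReal ε := by
    rw [← ENNReal.ofReal_ofNat, ← ENNReal.ofReal_mul (by norm_num)]
    congr 1
    ring
  have e3 : (((3 / 2 : ℝ≥0) : ℝ≥0∞)) = 3 / 2 := by
    rw [ENNReal.coe_div (by norm_num)]
    norm_num
  rw [e3] at h3
  calc _ ≤ _ := h3
    _ ≤ 3 * (16 * h + 64 * pen m + 16 * U + ENNReal.ofReal (ε / 3)) +
        3 / 2 * (2 * (2 * (pen m + pen m) + U) + 2 * (2 * h)) := by
        push_cast
        gcongr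
    _ = 3 * (16 * h + 64 * pen m + 16 * U) + 3 * ENNReal.ofReal (ε / 3) +
        (3 / 2 * 2) * ((2 * (pen m + pen m) + U) + 2 * h) := by ring
    _ = _ := by rw [e1, e2]; ring

end Oracle

end Selection

/-! ### Stochastic control of the histograms -/

section Stochastic

variable {X Ω : Type*} [MeasurableSpace X] [MeasurableSpace Ω] {P : Measure Ω}
  {n : ℕ}

/-- The intensity measure of `∑ j, N^j`, as a real valued set function. -/
def intensity (P : Measure Ω) (Nj : Fin n → Ω → Measure X) (J : Set X) : ℝ :=
  ∑ j, ∫ ω, (Nj j ω).real J ∂P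

/-- The deviations of the cell counts. -/
def countDev (P : Measure Ω) (Nj : Fin n → Ω → Measure X) (F : Finset (Set X)) (ω : Ω) : ℝ :=
  ∑ J ∈ F, (√(∑ j, (Nj j ω).real J) - √(intensity P Nj J)) ^ 2

lemma measurable_countDev {Nj : Fin n → Ω → Measure X} (hNj : ∀ j, Measurable (Nj j))
    {F : Finset (Set X)} (hF : ∀ J ∈ F, MeasurableSet J) :
    Measurable (countDev P Nj F) := by
  refine Finset.measurable_sum _ fun J hJ => ?_
  have : ∀ j, Measurable fun ω => (Nj j ω).real J := fun j =>
    ((Measure.measurable_coe (hF J hJ)).comp (hNj j)).ennreal_toReal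
  fun_prop

variable [IsProbabilityMeasure P]

/-- Disjoint cells share a total mass at most `k`, so dividing the counts by `k` gives vectors of
sum at most 1. This rescales the squared deviations by `1 / k`, whence `4 k`. -/
lemma lintegral_exp_countDev_le {Nj : Fin n → Ω → Measure X} (hNj : ∀ j, Measurable (Nj j))
    (hind : iIndepFun Nj P) {k : ℕ} (hk : 0 < k) (hNk : ∀ j, ∀ᵐ ω ∂P, Nj j ω univ ≤ k)
    {F : Finset (Set X)} (hF : ∀ J ∈ F, MeasurableSet J)
    (hdis : (F : Set (Set X)).PairwiseDisjoint id) :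
    ∫⁻ ω, ENNReal.ofReal (Real.exp (countDev P Nj F ω / (4 * k))) ∂P ≤
      ENNReal.ofReal (Real.exp (4 * F.card)) := by
  have hk' : (0 : ℝ) < k := by exact_mod_cast hk
  let g : Measure X → F → ℝ := fun ν i => ν.real i / k
  have hg : Measurable g := measurable_pi_iff.2 fun i =>
    ((Measure.measurable_coe (hF i i.2)).ennreal_toReal).div_const _
  have h := lintegral_exp_sum_sq_sqrt_sub_le (P := P) (a := fun j ω => g (Nj j ω))
    (fun j => hg.comp (hNj j)) (hind.comp (fun _ => g) fun _ => hg)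
    (fun j => ae_of_all _ fun ω i => by simp only [g]; positivity)
    (fun j => by
      filter_upwards [hNk j] with ω hω
      have hfin : ∀ A, Nj j ω A ≠ ∞ := fun A =>
        (((measure_mono (subset_univ A)).trans hω).trans_lt (ENNReal.natCast_lt_top k)).ne
      simp only [g]
      rw [← Finset.sum_div, div_le_one hk', Finset.sum_coe_sort F fun i => (Nj j ω).real i]
      have e := measure_biUnion_finset (μ := Nj j ω) hdis (fun J hJ => hF J hJ)
      have e' : ∑ J ∈ F, (Nj j ω).real J = (Nj j ω (⋃ J ∈ F, id J)).toReal := by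
        rw [e, ENNReal.toReal_sum fun J _ => hfin _]
        rfl
      rw [e']
      exact ENNReal.toReal_le_of_le_ofReal hk'.le
        (((measure_mono (subset_univ _)).trans hω).trans (by simp)))
  simp only [Fintype.card_coe] at h
  refine (le_of_eq ?_).trans h
  refine lintegral_congr fun ω => ?_
  congr 2
  rw [countDev, ← Finset.sum_coe_sort F, mul_comm, ← div_div, Finset.sum_div]
  congr 1
  refine Finset.sum_congr rfl fun i _ => ?_
  simp only [g, integral_div, ← Finset.sum_div]
  rw [Real.sqrt_div' _ hk'.le, Real.sqrt_div' _ hk'.le, ← sub_div, div_pow, Real.sq_sqrt hk'.le]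
  rfl

/-- The mean `x ↦ E[∑ j, Y^j(x)]`. -/
def meanProc (P : Measure Ω) (Y : Fin n → X → Ω → ℝ≥0) (x : X) : ℝ :=
  ∑ j, ∫ ω, (Y j x ω : ℝ) ∂P

/-- The deviation `(√y - √E y)²` at `x` of `y = ∑ j, Y^j`. -/
def procDev (P : Measure Ω) (Y : Fin n → X → Ω → ℝ≥0) (x : X) (ω : Ω) : ℝ :=
  (√(∑ j, (Y j x ω : ℝ)) - √(meanProc P Y x)) ^ 2

/-! ### Deviations of the process `∑ j, Y^j`, point by point. -/

section Proc

variable {Y : Fin n → X → Ω → ℝ≥0}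

lemma measurable_proc_left (hY : ∀ j, Measurable fun p : X × Ω => Y j p.1 p.2)
    (j : Fin n) (x : X) : Measurable fun ω => Y j x ω :=
  (hY j).comp measurable_prodMk_left

lemma measurable_proc_right (hY : ∀ j, Measurable fun p : X × Ω => Y j p.1 p.2)
    (j : Fin n) (ω : Ω) : Measurable fun x => Y j x ω :=
  (hY j).comp measurable_prodMk_right

lemma measurable_meanProc (hY : ∀ j, Measurable fun p : X × Ω => Y j p.1 p.2) :
    Measurable (meanProc P Y) := by
  refine Finset.measurable_sum _ fun j _ => ?_
  have : StronglyMeasurable fun p : X × Ω => (Y j p.1 p.2 : ℝ) :=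
    (hY j).coe_nnreal_real.stronglyMeasurable
  exact (this.integral_prod_right' (ν := P)).measurable

lemma measurable_procDev (hY : ∀ j, Measurable fun p : X × Ω => Y j p.1 p.2) :
    Measurable fun p : X × Ω => procDev P Y p.1 p.2 := by
  have h1 : Measurable fun p : X × Ω => meanProc P Y p.1 :=
    (measurable_meanProc hY).comp measurable_fst
  have h2 : Measurable fun p : X × Ω => ∑ j, (Y j p.1 p.2 : ℝ) :=
    Finset.measurable_sum _ fun j _ => (hY j).coe_nnreal_real
  unfold procDev
  fun_prop

/-- The exponential moment bound for vectors with a single coordinate, at fixed `x`. -/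
lemma lintegral_exp_procDev_le (hY : ∀ j, Measurable fun p : X × Ω => Y j p.1 p.2)
    (hind : iIndepFun (fun j ω x => Y j x ω) P)
    (hY1 : ∀ j x, ∀ᵐ ω ∂P, Y j x ω ≤ 1) (x : X) :
    ∫⁻ ω, ENNReal.ofReal (Real.exp (procDev P Y x ω / 4)) ∂P ≤ ENNReal.ofReal (Real.exp 4) := by
  let g : (X → ℝ≥0) → Unit → ℝ := fun f _ => f x
  have hg : Measurable g := measurable_pi_iff.2 fun _ => (measurable_pi_apply x).coe_nnreal_real
  have h := lintegral_exp_sum_sq_sqrt_sub_le (P := P) (a := fun j ω => g fun x => Y j x ω)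
    (fun j => measurable_pi_iff.2 fun _ => (measurable_proc_left hY j x).coe_nnreal_real)
    (hind.comp (fun _ => g) fun _ => hg) (fun j => ae_of_all _ fun ω i => (Y j x ω).coe_nonneg)
    (fun j => by
      filter_upwards [hY1 j x] with ω hω
      simpa [g] using hω)
  simpa [g, procDev, meanProc] using h

/-- Equality in law bounds the copies by 1 only almost surely for each `x`; Fubini turns this into
one null set of `ω`, outside which the bound holds for almost every `x`. -/
lemma ae_ae_proc_le_one (hY : ∀ j, Measurable fun p : X × Ω => Y j p.1 p.2)
    {l : Measure X} [SFinite l] (hY1 : ∀ j x, ∀ᵐ ω ∂P, Y j x ω ≤ 1) :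
    ∀ᵐ ω ∂P, ∀ j, ∀ᵐ x ∂l, Y j x ω ≤ 1 := by
  refine ae_all_iff.2 fun j => ?_
  have hm : MeasurableSet {p : X × Ω | Y j p.1 p.2 ≤ 1} := hY j measurableSet_Iic
  exact (Measure.ae_ae_comm hm).1 (ae_of_all _ (hY1 j))

end Proc

/-- `∫ s (√y - √E y)² dl`, which controls `∑_J (√∫_J s dM - √E[∫_J s dM])²` for all partitions. -/
def totalProcDev (P : Measure Ω) (l : Measure X) (s : X → ℝ≥0) (Y : Fin n → X → Ω → ℝ≥0) (ω : Ω) :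
    ℝ≥0∞ :=
  ∫⁻ x, s x * ENNReal.ofReal (procDev P Y x ω) ∂l

/-- Square roots contract under integration on each cell, and the cellwise bounds add up to an
integral over `X`. The result depends neither on the partition nor on its cardinality. -/
lemma sum_mean_dev_le {l : Measure X} {s : X → ℝ≥0} (hs : Measurable s)
    (hsi : Integrable (fun x => (s x : ℝ)) l) {Y : Fin n → X → Ω → ℝ≥0}
    (hY : ∀ j, Measurable fun p : X × Ω => Y j p.1 p.2) (hY1 : ∀ j x, ∀ᵐ ω ∂P, Y j x ω ≤ 1)
    {ω : Ω} (hω : ∀ j, ∀ᵐ x ∂l, Y j x ω ≤ 1) {V : SetPartition X} (hV : IsMeasurablePartition V)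
    {F : Finset (Set X)} (hFV : F ⊆ V.parts) :
    ∑ J ∈ F, ENNReal.ofReal ((√(∫ x in J, (s x : ℝ) * ∑ j, (Y j x ω : ℝ) ∂l) -
      √(∫ x in J, (s x : ℝ) * meanProc P Y x ∂l)) ^ 2) ≤ totalProcDev P l s Y ω := by
  have hmean0 : ∀ x, 0 ≤ meanProc P Y x := fun x =>
    Finset.sum_nonneg fun j _ => integral_nonneg fun ω => (Y j x ω).coe_nonneg
  have hi1 : Integrable (fun x => (s x : ℝ) * ∑ j, (Y j x ω : ℝ)) l := by
    refine Integrable.mono' (hsi.mul_const (n : ℝ)) ?_ ?_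
    · have := fun j => measurable_proc_right hY j ω
      exact (hs.coe_nnreal_real.mul
        (Finset.measurable_sum _ fun j _ => (this j).coe_nnreal_real)).aestronglyMeasurable
    · filter_upwards [ae_all_iff.2 hω] with x hx
      rw [Real.norm_of_nonneg (by positivity)]
      gcongr
      calc ∑ j, (Y j x ω : ℝ) ≤ ∑ _j : Fin n, (1 : ℝ) :=
            Finset.sum_le_sum fun j _ => by exact_mod_cast hx j
        _ = n := by simp
  have hi2 : Integrable (fun x => (s x : ℝ) * meanProc P Y x) l := by
    refine Integrable.mono' (hsi.mul_const (n : ℝ))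
      (hs.coe_nnreal_real.mul (measurable_meanProc hY)).aestronglyMeasurable
      (ae_of_all _ fun x => ?_)
    rw [Real.norm_of_nonneg (mul_nonneg (s x).coe_nonneg (hmean0 x))]
    gcongr
    calc meanProc P Y x ≤ ∑ _j : Fin n, (1 : ℝ) := by
          refine Finset.sum_le_sum fun j _ => ?_
          have := integral_mono_of_nonneg (μ := P) (f := fun ω => (Y j x ω : ℝ)) (g := fun _ => 1)
            (ae_of_all _ fun ω => (Y j x ω).coe_nonneg) (integrable_const _)
            ((hY1 j x).mono fun ω h => by exact_mod_cast h)
          simpa using this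
      _ = n := by simp
  have hsq : ∀ x, ENNReal.ofReal ((√((s x : ℝ) * ∑ j, (Y j x ω : ℝ)) -
      √((s x : ℝ) * meanProc P Y x)) ^ 2) = s x * ENNReal.ofReal (procDev P Y x ω) := by
    intro x
    rw [Real.sqrt_mul (s x).coe_nonneg, Real.sqrt_mul (s x).coe_nonneg, ← mul_sub, mul_pow,
      Real.sq_sqrt (s x).coe_nonneg, ENNReal.ofReal_mul (s x).coe_nonneg,
      ENNReal.ofReal_coe_nnreal]
    rfl
  calc _ ≤ ∑ J ∈ F, ∫⁻ x in J, s x * ENNReal.ofReal (procDev P Y x ω) ∂l := by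
        refine Finset.sum_le_sum fun J _ => ?_
        simp_rw [← hsq]
        exact sq_sqrt_integral_sub_le (l.restrict J) hi1.integrableOn hi2.integrableOn
          (fun x => by positivity) (fun x => mul_nonneg (s x).coe_nonneg (hmean0 x))
    _ ≤ ∑ J ∈ V.parts, ∫⁻ x in J, s x * ENNReal.ofReal (procDev P Y x ω) ∂l :=
        Finset.sum_le_sum_of_subset hFV
    _ = _ := (lintegral_eq_sum_parts hV _ _).symm

end Stochastic

/-! ### Risk of the remainder terms -/

section Remainder

variable {X Ω : Type*} [MeasurableSpace X] [MeasurableSpace Ω] {P : Measure Ω} {n : ℕ}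

/-- Excess of `countDev` over `4 k (4 |F| + x)`, in exponential form. -/
def countErr (P : Measure Ω) (Nj : Fin n → Ω → Measure X) (k : ℕ) (F : Finset (Set X)) (x : ℝ)
    (ω : Ω) : ℝ≥0∞ :=
  ENNReal.ofReal (4 * k * Real.exp (-(4 * F.card) - x)) *
    ENNReal.ofReal (Real.exp (countDev P Nj F ω / (4 * k)))

/-- Excess of `totalProcDev` over `4 x ∫ s dl`, in exponential form. -/
def procErr (P : Measure Ω) (l : Measure X) (s : X → ℝ≥0) (Y : Fin n → X → Ω → ℝ≥0) (x : ℝ)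
    (ω : Ω) : ℝ≥0∞ :=
  ENNReal.ofReal (4 * Real.exp (-x)) *
    ∫⁻ u, s u * ENNReal.ofReal (Real.exp (procDev P Y u ω / 4)) ∂l

/-- This is `1 + u ≤ e^u` at `u = countDev / (4 k) - 4 |F| - x`; the shift `4 |F|` matches the
exponential moment `e^{4 |F|}`. -/
lemma countDev_le {Nj : Fin n → Ω → Measure X} {k : ℕ} (hk : 0 < k) (F : Finset (Set X)) {x : ℝ}
    (hx : 0 ≤ x) (ω : Ω) :
    ENNReal.ofReal (countDev P Nj F ω) ≤
      ENNReal.ofReal (4 * k * (4 * F.card + x)) + countErr P Nj k F x ω := by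
  have hk' : (0 : ℝ) < k := by exact_mod_cast hk
  unfold countErr
  rw [← ENNReal.ofReal_mul (by positivity), ← ENNReal.ofReal_add (by positivity) (by positivity)]
  refine ENNReal.ofReal_le_ofReal ?_
  rw [mul_assoc (4 * (k : ℝ)), ← Real.exp_add]
  have h := Real.add_one_le_exp (-(4 * (F.card : ℝ)) - x + countDev P Nj F ω / (4 * k))
  have e : countDev P Nj F ω = 4 * k * (countDev P Nj F ω / (4 * k)) := by field_simp
  have : 0 ≤ 4 * (k : ℝ) := by positivity
  nlinarith

lemma measurable_totalProcDev_integrand {s : X → ℝ≥0} (hs : Measurable s)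
    {Y : Fin n → X → Ω → ℝ≥0} [IsProbabilityMeasure P]
    (hY : ∀ j, Measurable fun p : X × Ω => Y j p.1 p.2) :
    Measurable fun p : X × Ω => (s p.1 : ℝ≥0∞) *
      ENNReal.ofReal (Real.exp (procDev P Y p.1 p.2 / 4)) := by
  have := measurable_procDev (P := P) hY
  have h2 : Measurable fun p : X × Ω => (s p.1 : ℝ≥0∞) := (hs.comp measurable_fst).coe_nnreal_ennreal
  fun_prop

/-- The same device under the integral sign. Here the moment bound `e⁴` is not subtracted from the
exponent but left in the remainder, so that the threshold `4 x ∫ s dl` is proportional to `x` and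
can be absorbed by the weights. -/
lemma totalProcDev_le (l : Measure X) {s : X → ℝ≥0} (hs : Measurable s)
    (Y : Fin n → X → Ω → ℝ≥0) {x : ℝ} (hx : 0 ≤ x) (ω : Ω) :
    totalProcDev P l s Y ω ≤
      ENNReal.ofReal (4 * x) * (∫⁻ u, s u ∂l) + procErr P l s Y x ω := by
  unfold totalProcDev procErr
  rw [← lintegral_const_mul' _ _ ENNReal.ofReal_ne_top,
    ← lintegral_const_mul' _ _ ENNReal.ofReal_ne_top,
    ← lintegral_add_left (hs.coe_nnreal_ennreal.const_mul _)]
  refine lintegral_mono fun u => ?_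
  have h : ENNReal.ofReal (procDev P Y u ω) ≤ ENNReal.ofReal (4 * x) +
      ENNReal.ofReal (4 * Real.exp (-x)) * ENNReal.ofReal (Real.exp (procDev P Y u ω / 4)) := by
    rw [← ENNReal.ofReal_mul (by positivity),
      ← ENNReal.ofReal_add (by positivity) (by positivity)]
    refine ENNReal.ofReal_le_ofReal ?_
    rw [mul_assoc 4, ← Real.exp_add]
    have := Real.add_one_le_exp (-x + procDev P Y u ω / 4)
    linarith
  calc _ ≤ (s u : ℝ≥0∞) * _ := mul_le_mul_right h _
    _ = _ := by ring

lemma measurable_countErr {Nj : Fin n → Ω → Measure X} (hNj : ∀ j, Measurable (Nj j))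
    {F : Finset (Set X)} (hF : ∀ J ∈ F, MeasurableSet J) (k : ℕ) (x : ℝ) :
    Measurable (countErr P Nj k F x) := by
  have := measurable_countDev (P := P) hNj hF
  unfold countErr
  fun_prop

lemma measurable_obsMeasure_apply {l : Measure X} [SFinite l] {Y : Fin n → X → Ω → ℝ≥0}
    (hY : ∀ j, Measurable fun p : X × Ω => Y j p.1 p.2) {I : Set X} (hI : MeasurableSet I) :
    Measurable fun ω => obsMeasure l (fun x ω => ∑ j, Y j x ω) ω I := by
  have hm : Measurable fun p : X × Ω => ((∑ j, Y j p.1 p.2 : ℝ≥0) : ℝ≥0∞) :=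
    (Finset.measurable_sum _ fun j _ => hY j).coe_nnreal_ennreal
  simp only [obsMeasure, withDensity_apply _ hI]
  exact hm.lintegral_prod_left' (μ := l.restrict I)

lemma ae_isRegularAt {l : Measure X} [SFinite l] {Y : Fin n → X → Ω → ℝ≥0}
    (hY : ∀ j, Measurable fun p : X × Ω => Y j p.1 p.2) {N M : Ω → Measure X}
    (hM : ∀ ω, M ω = obsMeasure l (fun x ω => ∑ j, Y j x ω) ω)
    (hNM : ∀ A, MeasurableSet A → P {ω | 0 < N ω A ∧ M ω A = 0} = 0)
    {V : SetPartition X} (hV : IsMeasurablePartition V) :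
    ∀ᵐ ω ∂P, IsRegularAt P N M V ω := by
  have h1 : ∀ I ∈ finiteParts P M V, ∀ᵐ ω ∂P, M ω I < ∞ ∧ (M ω I = 0 → N ω I = 0) := by
    intro I hI
    have hIm := hV I (finiteParts_subset V hI)
    have hmeas : Measurable fun ω => M ω I := by
      simp only [hM]
      exact measurable_obsMeasure_apply hY hIm
    have h2 := ae_lt_top hmeas (mem_finiteParts.1 hI).2.ne
    have h3 : ∀ᵐ ω ∂P, ¬ (0 < N ω I ∧ M ω I = 0) := by
      rw [ae_iff]
      simpa only [not_not] using hNM I hIm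
    filter_upwards [h2, h3] with ω h2 h3
    refine ⟨h2, fun h0 => ?_⟩
    by_contra hc
    exact h3 ⟨pos_iff_ne_zero.2 hc, h0⟩
  have h2 := (ae_ball_iff (finiteParts P M V).countable_toSet).2 h1
  filter_upwards [h2] with ω h
  exact ⟨fun I hI => (h I hI).1, fun I hI => (h I hI).2⟩

variable [IsProbabilityMeasure P]

lemma measurable_procErr {l : Measure X} [SFinite l] {s : X → ℝ≥0} (hs : Measurable s)
    {Y : Fin n → X → Ω → ℝ≥0} (hY : ∀ j, Measurable fun p : X × Ω => Y j p.1 p.2) (x : ℝ) :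
    Measurable (procErr P l s Y x) :=
  ((measurable_totalProcDev_integrand hs hY).lintegral_prod_left').const_mul _

lemma lintegral_countErr_le {Nj : Fin n → Ω → Measure X} (hNj : ∀ j, Measurable (Nj j))
    (hind : iIndepFun Nj P) {k : ℕ} (hk : 0 < k) (hNk : ∀ j, ∀ᵐ ω ∂P, Nj j ω univ ≤ k)
    {F : Finset (Set X)} (hF : ∀ J ∈ F, MeasurableSet J)
    (hdis : (F : Set (Set X)).PairwiseDisjoint id) (x : ℝ) :
    ∫⁻ ω, countErr P Nj k F x ω ∂P ≤ ENNReal.ofReal (4 * k * Real.exp (-x)) := by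
  unfold countErr
  rw [lintegral_const_mul' _ _ ENNReal.ofReal_ne_top]
  calc _ ≤ ENNReal.ofReal (4 * k * Real.exp (-(4 * F.card) - x)) *
        ENNReal.ofReal (Real.exp (4 * F.card)) :=
        mul_le_mul_right (lintegral_exp_countDev_le hNj hind hk hNk hF hdis) _
    _ = _ := by
        rw [← ENNReal.ofReal_mul (by positivity), mul_assoc (4 * (k : ℝ)), ← Real.exp_add]
        congr 3
        ring

lemma lintegral_procErr_le {l : Measure X} [SFinite l] {s : X → ℝ≥0} (hs : Measurable s)
    {Y : Fin n → X → Ω → ℝ≥0} (hY : ∀ j, Measurable fun p : X × Ω => Y j p.1 p.2)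
    (hind : iIndepFun (fun j ω x => Y j x ω) P) (hY1 : ∀ j x, ∀ᵐ ω ∂P, Y j x ω ≤ 1) (x : ℝ) :
    ∫⁻ ω, procErr P l s Y x ω ∂P ≤
      ENNReal.ofReal (4 * Real.exp 4 * Real.exp (-x)) * ∫⁻ u, s u ∂l := by
  unfold procErr
  have hm := measurable_totalProcDev_integrand (P := P) hs hY
  rw [lintegral_const_mul' _ _ ENNReal.ofReal_ne_top,
    lintegral_lintegral_swap (by exact (hm.comp measurable_swap).aemeasurable)]
  calc _ ≤ ENNReal.ofReal (4 * Real.exp (-x)) *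
        ∫⁻ u, s u * ENNReal.ofReal (Real.exp 4) ∂l := by
        gcongr with u
        rw [lintegral_const_mul' _ _ ENNReal.coe_ne_top]
        exact mul_le_mul_right (lintegral_exp_procDev_le hY hind hY1 u) _
    _ = _ := by
        rw [lintegral_mul_const _ hs.coe_nnreal_ennreal, mul_comm (lintegral _ _), ← mul_assoc,
          ← ENNReal.ofReal_mul (by positivity)]
        congr 2
        ring

lemma intensity_eq_setIntegral {l : Measure X} {s : X → ℝ≥0} (hs : Measurable s)
    (hsi : Integrable (fun x => (s x : ℝ)) l) {Nj : Fin n → Ω → Measure X}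
    (hNj : ∀ j, Measurable (Nj j)) (hNfin : ∀ j, ∀ᵐ ω ∂P, Nj j ω univ < ∞)
    {Y : Fin n → X → Ω → ℝ≥0} (hY : ∀ j, Measurable fun p : X × Ω => Y j p.1 p.2)
    (hY1 : ∀ j x, ∀ᵐ ω ∂P, Y j x ω ≤ 1)
    (hmean : ∀ j J, MeasurableSet J →
      ∫⁻ ω, Nj j ω J ∂P = ∫⁻ x in J, s x * ∫⁻ ω, Y j x ω ∂P ∂l)
    {J : Set X} (hJ : MeasurableSet J) :
    intensity P Nj J = ∫ x in J, (s x : ℝ) * meanProc P Y x ∂l := by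
  have hYi : ∀ j x, Integrable (fun ω => (Y j x ω : ℝ)) P := fun j x =>
    Integrable.of_bound (measurable_proc_left hY j x).coe_nnreal_real.aestronglyMeasurable 1
      ((hY1 j x).mono fun ω h => by simpa using h)
  have hYm : ∀ j x, ∫⁻ ω, Y j x ω ∂P = ENNReal.ofReal (∫ ω, (Y j x ω : ℝ) ∂P) := by
    intro j x
    rw [ofReal_integral_eq_lintegral_ofReal (hYi j x)
      (ae_of_all _ fun ω => (Y j x ω).coe_nonneg)]
    simp
  have h0 : ∀ j x, 0 ≤ ∫ ω, (Y j x ω : ℝ) ∂P := fun j x =>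
    integral_nonneg fun ω => (Y j x ω).coe_nonneg
  have h1 : ∀ j x, ∫ ω, (Y j x ω : ℝ) ∂P ≤ 1 := fun j x => by
    have := integral_mono_ae (hYi j x) (integrable_const (1 : ℝ))
      ((hY1 j x).mono fun ω h => by exact_mod_cast h)
    simpa using this
  have hmm : ∀ j, Measurable fun x => ∫ ω, (Y j x ω : ℝ) ∂P := fun j => by
    have : StronglyMeasurable fun p : X × Ω => (Y j p.1 p.2 : ℝ) :=
      (hY j).coe_nnreal_real.stronglyMeasurable
    exact (this.integral_prod_right' (ν := P)).measurable
  have hi : ∀ j, Integrable (fun x => (s x : ℝ) * ∫ ω, (Y j x ω : ℝ) ∂P) l := fun j =>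
    Integrable.mono' hsi (hs.coe_nnreal_real.mul (hmm j)).aestronglyMeasurable
      (ae_of_all _ fun x => by
        rw [Real.norm_of_nonneg (mul_nonneg (s x).coe_nonneg (h0 j x))]
        exact mul_le_of_le_one_right (s x).coe_nonneg (h1 j x))
  simp only [intensity, meanProc, Finset.mul_sum]
  rw [integral_finsetSum _ fun j _ => (hi j).integrableOn]
  refine Finset.sum_congr rfl fun j _ => ?_
  have e1 : ∫ ω, (Nj j ω).real J ∂P = (∫⁻ ω, Nj j ω J ∂P).toReal :=
    integral_toReal ((Measure.measurable_coe hJ).comp (hNj j)).aemeasurable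
      ((hNfin j).mono fun ω h => (measure_mono (subset_univ J)).trans_lt h)
  rw [e1, hmean j J hJ, integral_eq_lintegral_of_nonneg_ae
    (ae_of_all _ fun x => mul_nonneg (s x).coe_nonneg (h0 j x))
    (hs.coe_nnreal_real.mul (hmm j)).aestronglyMeasurable]
  congr 1
  refine lintegral_congr fun x => ?_
  rw [hYm, ENNReal.ofReal_mul (s x).coe_nonneg, ENNReal.ofReal_coe_nnreal]

lemma withDensity_obsMeasure_univ_lt_top {l : Measure X} {s : X → ℝ≥0} (hs : Measurable s)
    (hsi : Integrable (fun x => (s x : ℝ)) l) {Y : Fin n → X → Ω → ℝ≥0}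
    (hY : ∀ j, Measurable fun p : X × Ω => Y j p.1 p.2) {ω : Ω}
    (hω : ∀ j, ∀ᵐ x ∂l, Y j x ω ≤ 1) :
    ((obsMeasure l (fun x ω => ∑ j, Y j x ω) ω).withDensity fun x => (s x : ℝ≥0∞)) univ < ∞ := by
  have hm : ∀ j, Measurable fun x => Y j x ω := fun j => measurable_proc_right hY j ω
  have hL : ∫⁻ x, s x ∂l < ∞ := by
    have := hsi.2
    rw [hasFiniteIntegral_iff_ofReal (ae_of_all _ fun x => (s x).coe_nonneg)] at this
    simpa using this
  rw [withDensity_apply _ MeasurableSet.univ, setLIntegral_univ, obsMeasure,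
    lintegral_withDensity_eq_lintegral_mul _
      (Finset.measurable_sum _ fun j _ => hm j).coe_nnreal_ennreal hs.coe_nnreal_ennreal]
  calc _ ≤ ∫⁻ x, (n : ℝ≥0∞) * s x ∂l := by
        refine lintegral_mono_ae ?_
        filter_upwards [ae_all_iff.2 hω] with x hx
        rw [Pi.mul_apply]
        gcongr
        calc ((∑ j, Y j x ω : ℝ≥0) : ℝ≥0∞) ≤ ((∑ _j : Fin n, 1 : ℝ≥0) : ℝ≥0∞) := by
              exact_mod_cast Finset.sum_le_sum fun j _ => hx j
          _ = n := by simp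
    _ = n * ∫⁻ x, s x ∂l := lintegral_const_mul' _ _ (by simp)
    _ < ∞ := ENNReal.mul_lt_top (by simp) hL

lemma withDensity_obsMeasure_real {l : Measure X} {s : X → ℝ≥0} (hs : Measurable s)
    {Y : Fin n → X → Ω → ℝ≥0} (hY : ∀ j, Measurable fun p : X × Ω => Y j p.1 p.2) (ω : Ω)
    {J : Set X} (hJ : MeasurableSet J) :
    ((obsMeasure l (fun x ω => ∑ j, Y j x ω) ω).withDensity fun x => (s x : ℝ≥0∞)).real J =
      ∫ x in J, (s x : ℝ) * ∑ j, (Y j x ω : ℝ) ∂l := by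
  have hm : ∀ j, Measurable fun x => Y j x ω := fun j => measurable_proc_right hY j ω
  have hms : Measurable fun x => (s x : ℝ) * ∑ j, (Y j x ω : ℝ) :=
    hs.coe_nnreal_real.mul (Finset.measurable_sum _ fun j _ => (hm j).coe_nnreal_real)
  rw [integral_eq_lintegral_of_nonneg_ae (ae_of_all _ fun x => by positivity)
    hms.aestronglyMeasurable, Measure.real, withDensity_apply _ hJ, obsMeasure,
    setLIntegral_withDensity_eq_setLIntegral_mul _
      (Finset.measurable_sum _ fun j _ => hm j).coe_nnreal_ennreal hs.coe_nnreal_ennreal hJ]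
  congr 1
  refine lintegral_congr fun x => ?_
  have : (s x : ℝ) * ∑ j, (Y j x ω : ℝ) = ((s x * ∑ j, Y j x ω : ℝ≥0) : ℝ) := by push_cast; rfl
  rw [this, ENNReal.ofReal_coe_nnreal, Pi.mul_apply]
  push_cast
  ring

/-- The stochastic error of the histogram is controlled by the deviations of the cell counts and of
the process `∑ j, Y^j`. -/
lemma hellingerSq_histEst_meanApprox_le {l : Measure X} {s : X → ℝ≥0} (hs : Measurable s)
    (hsi : Integrable (fun x => (s x : ℝ)) l) {Nj : Fin n → Ω → Measure X}
    {Y : Fin n → X → Ω → ℝ≥0} (hY : ∀ j, Measurable fun p : X × Ω => Y j p.1 p.2)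
    (hY1 : ∀ j x, ∀ᵐ ω ∂P, Y j x ω ≤ 1)
    (hint : ∀ J, MeasurableSet J →
      intensity P Nj J = ∫ x in J, (s x : ℝ) * meanProc P Y x ∂l)
    {N M : Ω → Measure X} {ω : Ω} (hNω : N ω = ∑ j, Nj j ω)
    (hMω : M ω = obsMeasure l (fun x ω => ∑ j, Y j x ω) ω)
    (hω : ∀ j, ∀ᵐ x ∂l, Y j x ω ≤ 1) (hNfin : N ω univ < ∞)
    {V : SetPartition X} (hV : IsMeasurablePartition V) (hr : IsRegularAt P N M V ω) :
    hellingerSq (M ω) (histEst P N M V ω) (meanApprox P M s V ω) ≤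
      2 * ENNReal.ofReal (countDev P Nj (finiteParts P M V) ω) +
        2 * totalProcDev P l s Y ω := by
  have hFV := finiteParts_subset (P := P) (M := M) V
  have hsum := sum_mean_dev_le (P := P) hs hsi hY hY1 hω hV hFV
  have hNsum : ∀ J, (N ω).real J = ∑ j, (Nj j ω).real J := by
    intro J
    have hJ : (N ω) J < ∞ := (measure_mono (subset_univ J)).trans_lt hNfin
    rw [hNω, Measure.finsetSum_apply] at hJ
    rw [hNω, Measure.real, Measure.finsetSum_apply,
      ENNReal.toReal_sum fun j hj => ((ENNReal.sum_lt_top.1 hJ) j hj).ne]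
    rfl
  calc _ ≤ ∑ J ∈ finiteParts P M V, ENNReal.ofReal ((√((N ω).real J) -
        √(((M ω).withDensity fun x => (s x : ℝ≥0∞)).real J)) ^ 2) :=
        hellingerSq_ratioFun_le_sum hV hFV hr.finite
    _ ≤ ∑ J ∈ finiteParts P M V,
        (2 * ENNReal.ofReal ((√(∑ j, (Nj j ω).real J) - √(intensity P Nj J)) ^ 2) +
          2 * ENNReal.ofReal ((√(∫ x in J, (s x : ℝ) * ∑ j, (Y j x ω : ℝ) ∂l) -
            √(∫ x in J, (s x : ℝ) * meanProc P Y x ∂l)) ^ 2)) := by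
        refine Finset.sum_le_sum fun J hJ => ?_
        have hJm := hV J (hFV hJ)
        rw [hNsum, hMω, withDensity_obsMeasure_real hs hY ω hJm, hint J hJm,
          ← ENNReal.ofReal_ofNat, ← ENNReal.ofReal_mul (by norm_num),
          ← ENNReal.ofReal_mul (by norm_num),
          ← ENNReal.ofReal_add (by positivity) (by positivity)]
        refine ENNReal.ofReal_le_ofReal ?_
        set A := √(∑ j, (Nj j ω).real J)
        set B := √(∫ x in J, (s x : ℝ) * ∑ j, (Y j x ω : ℝ) ∂l)
        set C := √(∫ x in J, (s x : ℝ) * meanProc P Y x ∂l)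
        nlinarith [sq_nonneg (A - C + (B - C))]
    _ ≤ _ := by
        rw [Finset.sum_add_distrib, ← Finset.mul_sum, ← Finset.mul_sum, countDev,
          ENNReal.ofReal_sum_of_nonneg fun J _ => sq_nonneg _]
        gcongr

end Remainder

/-! ### The risk bound -/

section Risk

variable {X Ω : Type*} [MeasurableSpace X] [MeasurableSpace Ω] {P : Measure Ω}

lemma le_mul_iInf_biasSq_add {𝓜 : Set (SetPartition X)} {pen : 𝓜 → ℝ≥0} {M : Ω → Measure X}
    {s : X → ℝ≥0} {ω : Ω} {A C : ℝ≥0∞}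
    (h : ∀ m : 𝓜, ∀ t ∈ model P M m.1,
      A ≤ 390 * (hellingerSq (M ω) s (fun x => t x ω) + pen m) + C) :
    A ≤ 390 * (⨅ m : 𝓜, (biasSq P M s m ω + (pen m : ℝ≥0∞))) + C := by
  simp only [biasSq, ENNReal.iInf_add, ENNReal.mul_iInf_of_ne (a := 390) (by simp) (by simp)]
  exact le_iInf fun m => le_iInf₂ fun t ht => h m t ht

variable [IsProbabilityMeasure P] {n : ℕ}

lemma tsum_ofReal_mul_prod {ι : Type*} {a : ι → ℝ} (ha : ∀ i, 0 ≤ a i) {S : ℝ} (hS : HasSum a S)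
    {C : ℝ} (hC : 0 ≤ C) :
    ∑' p : ι × ι, ENNReal.ofReal (C * (a p.1 * a p.2)) = ENNReal.ofReal (C * S ^ 2) := by
  have hS' : ∑' i, ENNReal.ofReal (a i) = ENNReal.ofReal S := by
    rw [← hS.tsum_eq, ENNReal.ofReal_tsum_of_nonneg ha hS.summable]
  simp_rw [ENNReal.ofReal_mul hC, ENNReal.tsum_mul_left, ENNReal.ofReal_mul (ha _)]
  rw [ENNReal.tsum_prod (f := fun i j => ENNReal.ofReal (a i) * ENNReal.ofReal (a j))]
  simp_rw [ENNReal.tsum_mul_left, ENNReal.tsum_mul_right, hS']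
  rw [← sq, ← ENNReal.ofReal_pow (hS.nonneg ha)]

lemma lintegral_tsum_remainder_le {l : Measure X} [SFinite l] {s : X → ℝ≥0} (hs : Measurable s)
    (hsi : Integrable (fun x => (s x : ℝ)) l) {Nj : Fin n → Ω → Measure X}
    (hNj : ∀ j, Measurable (Nj j)) (hNind : iIndepFun Nj P) {k : ℕ} (hk : 0 < k)
    (hNk : ∀ j, ∀ᵐ ω ∂P, Nj j ω univ ≤ k) {Y : Fin n → X → Ω → ℝ≥0}
    (hY : ∀ j, Measurable fun p : X × Ω => Y j p.1 p.2)
    (hYind : iIndepFun (fun j ω x => Y j x ω) P) (hY1 : ∀ j x, ∀ᵐ ω ∂P, Y j x ω ≤ 1)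
    {ι : Type*} [Countable ι] (V : ι × ι → SetPartition X)
    (hV : ∀ p, IsMeasurablePartition (V p)) (F : ι × ι → Finset (Set X))
    (hF : ∀ p, F p ⊆ (V p).parts) {y : ι → ℝ} {S : ℝ}
    (hS : HasSum (fun i => Real.exp (-y i)) S) :
    ∫⁻ ω, ∑' p : ι × ι, (2 * countErr P Nj k (F p) (y p.1 + y p.2) ω +
      2 * procErr P l s Y (y p.1 + y p.2) ω) ∂P ≤
      ENNReal.ofReal (648 * (k + ∫ x, (s x : ℝ) ∂l) * S ^ 2) := by
  have hFm : ∀ p, ∀ J ∈ F p, MeasurableSet J := fun p J hJ => hV p J (hF p hJ)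
  have hL : ∫⁻ x, s x ∂l = ENNReal.ofReal (∫ x, (s x : ℝ) ∂l) := by
    rw [ofReal_integral_eq_lintegral_ofReal hsi (ae_of_all _ fun x => (s x).coe_nonneg)]
    simp
  have hL0 : 0 ≤ ∫ x, (s x : ℝ) ∂l := integral_nonneg fun x => (s x).coe_nonneg
  set L := ∫ x, (s x : ℝ) ∂l
  have hm1 := fun p => measurable_countErr (P := P) hNj (hFm p) k (y p.1 + y p.2)
  have hm2 := fun p : ι × ι => measurable_procErr (P := P) (l := l) hs hY (y p.1 + y p.2)
  have hm : ∀ p, Measurable fun ω => 2 * countErr P Nj k (F p) (y p.1 + y p.2) ω +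
      2 * procErr P l s Y (y p.1 + y p.2) ω := fun p =>
    ((hm1 p).const_mul _).add ((hm2 p).const_mul _)
  rw [lintegral_tsum fun p => (hm p).aemeasurable,
    ← tsum_ofReal_mul_prod (fun i => (Real.exp_pos _).le) hS (by positivity)]
  refine ENNReal.tsum_le_tsum fun p => ?_
  rw [lintegral_add_left ((hm1 p).const_mul _), lintegral_const_mul _ (hm1 p),
    lintegral_const_mul _ (hm2 p)]
  have h1 := lintegral_countErr_le hNj hNind hk hNk (hFm p)
    ((V p).disjoint.subset (hF p)) (y p.1 + y p.2)
  have h2 := lintegral_procErr_le (l := l) hs hY hYind hY1 (y p.1 + y p.2)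
  rw [hL] at h2
  -- This is the source of `648 = 2 * 4 * 81`.
  have he : Real.exp 4 ≤ 81 := by
    have h3 : Real.exp 4 = Real.exp 1 ^ 4 := by rw [← Real.exp_nat_mul]; norm_num
    have h4 : Real.exp 1 ≤ 3 := by have := Real.exp_one_lt_d9; linarith
    rw [h3]
    calc Real.exp 1 ^ 4 ≤ 3 ^ 4 := by gcongr
      _ = 81 := by norm_num
  calc _ ≤ 2 * ENNReal.ofReal (4 * k * Real.exp (-(y p.1 + y p.2))) +
        2 * (ENNReal.ofReal (4 * Real.exp 4 * Real.exp (-(y p.1 + y p.2))) *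
          ENNReal.ofReal L) := by gcongr
    _ ≤ _ := by
        rw [← ENNReal.ofReal_mul (by positivity), ← ENNReal.ofReal_ofNat,
          ← ENNReal.ofReal_mul (by norm_num), ← ENNReal.ofReal_mul (by norm_num),
          ← ENNReal.ofReal_add (by positivity) (by positivity), ← Real.exp_add, ← neg_add]
        refine ENNReal.ofReal_le_ofReal ?_
        have hE := Real.exp_pos (-(y p.1 + y p.2))
        set E := Real.exp (-(y p.1 + y p.2))
        have : Real.exp 4 * (E * L) ≤ 81 * (E * L) := by gcongr
        have : 0 ≤ (k : ℝ) * E := by positivity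
        nlinarith

/-- Risk bound for the selected histogram, for a random measure with intensity
`E[∫ s dM]` whose components have mass at most `k`. -/
theorem lintegral_hellingerSq_selected_le {l : Measure X} [SFinite l] {s : X → ℝ≥0}
    (hs : Measurable s) (hsi : Integrable (fun x => (s x : ℝ)) l) {Nj : Fin n → Ω → Measure X}
    (hNj : ∀ j, Measurable (Nj j)) (hNind : iIndepFun Nj P) {k : ℕ} (hk : 0 < k)
    (hNk : ∀ j, ∀ᵐ ω ∂P, Nj j ω univ ≤ k) {Y : Fin n → X → Ω → ℝ≥0}
    (hY : ∀ j, Measurable fun p : X × Ω => Y j p.1 p.2)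
    (hYind : iIndepFun (fun j ω x => Y j x ω) P) (hY1 : ∀ j x, ∀ᵐ ω ∂P, Y j x ω ≤ 1)
    (hmean : ∀ j J, MeasurableSet J →
      ∫⁻ ω, Nj j ω J ∂P = ∫⁻ x in J, s x * ∫⁻ ω, Y j x ω ∂P ∂l)
    {N M : Ω → Measure X} (hN : ∀ ω, N ω = ∑ j, Nj j ω)
    (hM : ∀ ω, M ω = obsMeasure l (fun x ω => ∑ j, Y j x ω) ω)
    (hNM : ∀ A, MeasurableSet A → P {ω | 0 < N ω A ∧ M ω A = 0} = 0)
    {𝓜 : Set (SetPartition X)} (h𝓜 : 𝓜.Countable)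
    (h𝓜_meas : ∀ m ∈ 𝓜, IsMeasurablePartition m) {Δ pen : 𝓜 → ℝ≥0} {η S : ℝ}
    (hη : η = (k : ℝ) * ((k : ℝ) + ∫ x, (s x : ℝ) ∂l)⁻¹)
    (hS : HasSum (fun m => Real.exp (-(η * (Δ m : ℝ)))) S)
    (hpen : ∀ m m' : 𝓜, 16 * (k : ℝ) * (refine m.1 m'.1).parts.card +
      4 * k * ((Δ m : ℝ) + Δ m') ≤ (pen m : ℝ) + pen m')
    {ε : ℝ} {mhat : Ω → 𝓜} (hmhat : ∀ᵐ ω ∂P, IsSelected P N M 𝓜 pen ε ω (mhat ω)) :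
    ∫⁻ ω, hellingerSq (M ω) (histEst P N M (mhat ω) ω) s ∂P ≤
      390 * ((∫⁻ ω, ⨅ m : 𝓜, (biasSq P M s m ω + (pen m : ℝ≥0∞)) ∂P)
        + ENNReal.ofReal (404 * (k : ℝ) * η⁻¹ * S ^ 2)) + ENNReal.ofReal ε := by
  have : Countable 𝓜 := h𝓜.to_subtype
  have hk' : (0 : ℝ) < k := by exact_mod_cast hk
  have hL0 : 0 ≤ ∫ x, (s x : ℝ) ∂l := integral_nonneg fun x => (s x).coe_nonneg
  have hL : ∫⁻ x, s x ∂l = ENNReal.ofReal (∫ x, (s x : ℝ) ∂l) := by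
    rw [ofReal_integral_eq_lintegral_ofReal hsi (ae_of_all _ fun x => (s x).coe_nonneg)]
    simp
  have hrem := lintegral_tsum_remainder_le (P := P) (l := l) hs hsi hNj hNind hk hNk hY hYind hY1
    (fun p : 𝓜 × 𝓜 => refine p.1.1 p.2.1)
    (fun p => isMeasurablePartition_refine (h𝓜_meas _ p.1.2) (h𝓜_meas _ p.2.2))
    (fun p => finiteParts P M (refine p.1.1 p.2.1)) (fun p => finiteParts_subset _)
    (y := fun m => η * (Δ m : ℝ)) hS
  have hint : ∀ J, MeasurableSet J →
      intensity P Nj J = ∫ x in J, (s x : ℝ) * meanProc P Y x ∂l := fun J hJ =>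
    intensity_eq_setIntegral hs hsi hNj
      (fun j => (hNk j).mono fun ω h => h.trans_lt (ENNReal.natCast_lt_top k)) hY hY1 hmean hJ
  set L := ∫ x, (s x : ℝ) ∂l
  have hηk : η * (k + L) = k := by rw [hη]; field_simp
  have hη0 : 0 < η := by rw [hη]; positivity
  set U : Ω → ℝ≥0∞ := fun ω => ∑' p : 𝓜 × 𝓜,
    (2 * countErr P Nj k (finiteParts P M (refine p.1.1 p.2.1)) (η * Δ p.1 + η * Δ p.2) ω +
      2 * procErr P l s Y (η * Δ p.1 + η * Δ p.2) ω)
  have hUm : Measurable U := by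
    refine Measurable.tsum fun p => ?_
    have hV := isMeasurablePartition_refine (h𝓜_meas _ p.1.2) (h𝓜_meas _ p.2.2)
    exact ((measurable_countErr hNj (fun J hJ => hV J (finiteParts_subset _ hJ)) k _).const_mul
      _).add ((measurable_procErr hs hY _).const_mul _)
  have hreg : ∀ᵐ ω ∂P, ∀ m ∈ 𝓜, ∀ m' ∈ 𝓜, IsRegularAt P N M (refine m m') ω :=
    (ae_ball_iff h𝓜).2 fun m hm => (ae_ball_iff h𝓜).2 fun m' hm' =>
      ae_isRegularAt hY hM hNM (isMeasurablePartition_refine (h𝓜_meas m hm) (h𝓜_meas m' hm'))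
  have hpt : ∀ᵐ ω ∂P, hellingerSq (M ω) (histEst P N M (mhat ω) ω) s ≤
      390 * (⨅ m : 𝓜, (biasSq P M s m ω + (pen m : ℝ≥0∞))) +
        (51 * U ω + ENNReal.ofReal ε) := by
    filter_upwards [hreg, hmhat, ae_all_iff.2 hNk, ae_ae_proc_le_one (l := l) hY hY1]
      with ω hr hsel hNω hYω
    have hNfin : N ω univ < ∞ := by
      rw [hN, Measure.finsetSum_apply]
      exact ENNReal.sum_lt_top.2 fun j _ => (hNω j).trans_lt (ENNReal.natCast_lt_top k)
    have hsfin : ((M ω).withDensity fun x => (s x : ℝ≥0∞)) univ < ∞ := by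
      rw [hM]; exact withDensity_obsMeasure_univ_lt_top hs hsi hY hYω
    -- The null set already discarded depends on neither `m` nor `t`, so the infimum over the
    -- possibly uncountable model is taken at fixed `ω`.
    refine le_mul_iInf_biasSq_add fun m t ht => ?_
    refine (hellingerSq_selected_le hs h𝓜_meas hNfin hsfin hr (U := U ω) ?_ hsel m ht).trans ?_
    · intro m m'
      have hV := isMeasurablePartition_refine (h𝓜_meas _ m.2) (h𝓜_meas _ m'.2)
      have hx : 0 ≤ η * (Δ m : ℝ) + η * Δ m' := by positivity
      have h1 := hellingerSq_histEst_meanApprox_le (P := P) hs hsi hY hY1 hint (hN ω) (hM ω) hYω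
        hNfin hV (hr m m.2 m' m'.2)
      have h2 := countDev_le (P := P) (Nj := Nj) hk (finiteParts P M (refine m.1 m'.1)) hx ω
      have h3 := totalProcDev_le (P := P) l hs Y hx ω
      have h4 : _ ≤ U ω := ENNReal.le_tsum (f := fun p : 𝓜 × 𝓜 =>
        (2 * countErr P Nj k (finiteParts P M (refine p.1.1 p.2.1)) (η * Δ p.1 + η * Δ p.2) ω +
          2 * procErr P l s Y (η * Δ p.1 + η * Δ p.2) ω)) (m, m')
      simp only at h4
      rw [hL] at h3
      set F := finiteParts P M (refine m.1 m'.1)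
      set x := η * (Δ m : ℝ) + η * Δ m'
      -- The left side is `32 k |F| + 8 x (k + L)`, and the choice of `η` gives `x (k + L) = k (Δ m
      -- + Δ m')`.
      have h5 : 2 * ENNReal.ofReal (4 * k * (4 * F.card + x)) +
          2 * (ENNReal.ofReal (4 * x) * ENNReal.ofReal L) ≤ 2 * ((pen m : ℝ≥0∞) + pen m') := by
        rw [← ENNReal.ofReal_coe_nnreal (p := pen m), ← ENNReal.ofReal_coe_nnreal (p := pen m'),
          ← mul_add, ← ENNReal.ofReal_mul (by positivity),
          ← ENNReal.ofReal_add (by positivity) (by positivity),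
          ← ENNReal.ofReal_add (by positivity) (by positivity)]
        refine mul_le_mul_right (ENNReal.ofReal_le_ofReal ?_) _
        refine le_trans ?_ (hpen m m')
        have hcard : (F.card : ℝ) ≤ (refine m.1 m'.1).parts.card := by
          exact_mod_cast Finset.card_le_card (finiteParts_subset _)
        have e : x * (k + L) = k * ((Δ m : ℝ) + Δ m') := by
          simp only [x]
          linear_combination ((Δ m : ℝ) + Δ m') * hηk
        have := mul_le_mul_of_nonneg_left hcard hk'.le
        nlinarith
      calc _ ≤ _ := h1
        _ ≤ 2 * (ENNReal.ofReal (4 * k * (4 * F.card + x)) + countErr P Nj k F x ω) +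
            2 * (ENNReal.ofReal (4 * x) * ENNReal.ofReal L + procErr P l s Y x ω) := by gcongr
        _ = (2 * ENNReal.ofReal (4 * k * (4 * F.card + x)) +
            2 * (ENNReal.ofReal (4 * x) * ENNReal.ofReal L)) +
            (2 * countErr P Nj k F x ω + 2 * procErr P l s Y x ω) := by ring
        _ ≤ _ := add_le_add h5 h4
    · rw [mul_add, add_assoc (_ + _)]
      gcongr <;> norm_num
  -- Since `k / η = k + L`, this is `51 * 648 ≤ 390 * 404`.
  have hR : 51 * ENNReal.ofReal (648 * (k + L) * S ^ 2) ≤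
      390 * ENNReal.ofReal (404 * (k : ℝ) * η⁻¹ * S ^ 2) := by
    have e : (k : ℝ) * η⁻¹ = k + L := by
      rw [← div_eq_mul_inv, div_eq_iff hη0.ne', mul_comm, hηk]
    rw [mul_assoc 404, e, ← ENNReal.ofReal_ofNat, ← ENNReal.ofReal_ofNat (n := 390),
      ← ENNReal.ofReal_mul (by norm_num), ← ENNReal.ofReal_mul (by norm_num)]
    refine ENNReal.ofReal_le_ofReal ?_
    have : 0 ≤ (k + L) * S ^ 2 := by positivity
    nlinarith
  calc _ ≤ ∫⁻ ω, (390 * (⨅ m : 𝓜, (biasSq P M s m ω + (pen m : ℝ≥0∞))) +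
        (51 * U ω + ENNReal.ofReal ε)) ∂P := lintegral_mono_ae hpt
    _ = 390 * (∫⁻ ω, ⨅ m : 𝓜, (biasSq P M s m ω + (pen m : ℝ≥0∞)) ∂P) +
        (51 * (∫⁻ ω, U ω ∂P) + ENNReal.ofReal ε) := by
        -- Only the second summand has to be measurable: the infimum of the biases, taken over
        -- random coefficients, is not known to be.
        rw [lintegral_add_right _ ((hUm.const_mul _).add_const _),
          lintegral_const_mul' _ _ (by simp), lintegral_add_right _ measurable_const,
          lintegral_const_mul _ hUm, lintegral_const, measure_univ, mul_one]
    _ ≤ 390 * (∫⁻ ω, ⨅ m : 𝓜, (biasSq P M s m ω + (pen m : ℝ≥0∞)) ∂P) +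
        (390 * ENNReal.ofReal (404 * (k : ℝ) * η⁻¹ * S ^ 2) + ENNReal.ofReal ε) := by
        exact add_le_add le_rfl (add_le_add ((mul_le_mul_right hrem _).trans hR) le_rfl)
    _ = _ := by ring

lemma lintegral_iInf_biasSq_add_le {𝓜 : Set (SetPartition X)} (pen : 𝓜 → ℝ≥0)
    (M : Ω → Measure X) (s : X → ℝ≥0) :
    ∫⁻ ω, ⨅ m : 𝓜, (biasSq P M s m ω + (pen m : ℝ≥0∞)) ∂P ≤
      ⨅ m : 𝓜, ((∫⁻ ω, biasSq P M s m ω ∂P) + (pen m : ℝ≥0∞)) := by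
  refine le_iInf fun m => ?_
  calc _ ≤ ∫⁻ ω, (biasSq P M s m ω + (pen m : ℝ≥0∞)) ∂P := lintegral_mono fun ω => iInf_le _ m
    _ = _ := by
      rw [lintegral_add_right _ measurable_const, lintegral_const, measure_univ, mul_one]

end Risk

/-- The relation `E[N(A)] = E[∫_A s Y dl]` extends from the intervals `[0, t]` to all measurable
sets. -/
lemma lintegral_measure_eq_of_Iic {X Ω : Type*} [TopologicalSpace X] [MeasurableSpace X]
    [SecondCountableTopology X] [LinearOrder X] [OrderTopology X] [BorelSpace X]
    [MeasurableSpace Ω] {P : Measure Ω} [IsProbabilityMeasure P] {l : Measure X} [SFinite l]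
    {s : X → ℝ≥0} (hs : Measurable s) {N : Ω → Measure X} (hN : Measurable N)
    {C : ℝ≥0∞} (hC : C < ∞) (hNC : ∀ᵐ ω ∂P, N ω univ ≤ C) {Y : X → Ω → ℝ≥0}
    (hY : Measurable fun p : X × Ω => Y p.1 p.2)
    (h : ∀ t, ∫⁻ ω, N ω (Iic t) ∂P =
      ∫⁻ ω, ∫⁻ x in Iic t, ((s x * Y x ω : ℝ≥0) : ℝ≥0∞) ∂l ∂P)
    {A : Set X} (hA : MeasurableSet A) :
    ∫⁻ ω, N ω A ∂P = ∫⁻ x in A, s x * ∫⁻ ω, Y x ω ∂P ∂l := by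
  have hm : Measurable fun p : X × Ω => ((s p.1 * Y p.1 p.2 : ℝ≥0) : ℝ≥0∞) :=
    ((hs.comp measurable_fst).mul hY).coe_nnreal_ennreal
  have hswap : ∀ A : Set X, ∫⁻ ω, ∫⁻ x in A, ((s x * Y x ω : ℝ≥0) : ℝ≥0∞) ∂l ∂P =
      ∫⁻ x in A, s x * ∫⁻ ω, Y x ω ∂P ∂l := by
    intro A
    rw [lintegral_lintegral_swap (by exact (hm.comp measurable_swap).aemeasurable)]
    refine lintegral_congr fun x => ?_
    push_cast
    rw [lintegral_const_mul' _ _ ENNReal.coe_ne_top]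
  have hfin : IsFiniteMeasure (Measure.bind P N) := ⟨by
    rw [Measure.bind_apply MeasurableSet.univ hN.aemeasurable]
    calc _ ≤ ∫⁻ _, C ∂P := lintegral_mono_ae hNC
      _ < ∞ := by simpa using hC⟩
  -- The mean measure of `N` is finite, hence determined by its values on the sets `Iic t`.
  have hext : Measure.bind P N = l.withDensity fun x => s x * ∫⁻ ω, Y x ω ∂P := by
    refine Measure.ext_of_Iic _ _ fun t => ?_
    rw [Measure.bind_apply measurableSet_Iic hN.aemeasurable,
      withDensity_apply _ measurableSet_Iic, h t, hswap]
  rw [← Measure.bind_apply hA hN.aemeasurable, hext, withDensity_apply _ hA]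

/-- Order convexity of `[0, ζ)` in `ℝ≥0` makes its subspace and order topologies agree, as required
to identify Borel measures by their distribution functions. -/
instance (ζ : ℝ≥0∞) : OrderTopology (TimeInterval ζ) :=
  have : OrdConnected {x : ℝ≥0 | (x : ℝ≥0∞) < ζ} :=
    ⟨fun _ _ _ hy _ hz => (ENNReal.coe_le_coe.2 hz.2).trans_lt hy⟩
  orderTopology_of_ordConnected (t := {x : ℝ≥0 | (x : ℝ≥0∞) < ζ})

end PenHist

end

/-! ### The risk bound for counting processes. -/

open PenHist in
theorem mainTheorem5
    -- the time interval `[0, ζ)`, the measure `l` and the unknown function `s`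
    (ζ : ℝ≥0∞) (hζ : 0 < ζ)
    (l : Measure (TimeInterval ζ)) [SigmaFinite l]
    (s : TimeInterval ζ → ℝ≥0) (hs : Measurable s)
    (hsint : Integrable (fun x => (s x : ℝ)) l)
    -- the counting process `N*` and the process `Y*`
    {Ω' : Type*} [MeasurableSpace Ω'] (P' : Measure Ω') [IsProbabilityMeasure P']
    (Nstar : Ω' → Measure (TimeInterval ζ)) (hNstar : Measurable Nstar)
    (hcount : ∀ ω, IsCountingMeasure (Nstar ω))
    (Ystar : TimeInterval ζ → Ω' → ℝ≥0)
    (hYstar : Measurable (fun p : TimeInterval ζ × Ω' => Ystar p.1 p.2))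
    (hYstar_le : ∀ x ω, Ystar x ω ≤ 1)
    (k : ℕ) (hk : 0 < k) (hNk : ∀ᵐ ω ∂P', Nstar ω Set.univ ≤ (k : ℝ≥0∞))
    (haalen : ∀ t, ∫⁻ ω, Nstar ω (Set.Iic t) ∂P' =
      ∫⁻ ω, ∫⁻ x in Set.Iic t, ((s x * Ystar x ω : ℝ≥0) : ℝ≥0∞) ∂l ∂P')
    (κ : ℝ) (hκ : 0 < κ)
    (hvar : ∀ I : Set (TimeInterval ζ), I.OrdConnected →
      variance (fun ω => ∫ x in I, (s x : ℝ) * (Ystar x ω : ℝ) ∂l) P' ≤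
        κ * ∫ ω, ∫ x in I, (s x : ℝ) * (Ystar x ω : ℝ) ∂l ∂P')
    -- the i.i.d. copies and the aggregated processes
    {Ω : Type*} [MeasurableSpace Ω] (P : Measure Ω) [IsProbabilityMeasure P] (n : ℕ)
    (Nj : Fin n → Ω → Measure (TimeInterval ζ)) (hNj : ∀ j, Measurable (Nj j))
    (hNj_indep : iIndepFun Nj P)
    (hNj_law : ∀ j, IdentDistrib (Nj j) Nstar P P')
    (Yj : Fin n → TimeInterval ζ → Ω → ℝ≥0)
    (hYj : ∀ j, Measurable (fun p : TimeInterval ζ × Ω => Yj j p.1 p.2))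
    (hYj_indep : iIndepFun (fun j ω x => Yj j x ω) P)
    (hYj_law : ∀ j, IdentDistrib (fun ω x => Yj j x ω) (fun ω x => Ystar x ω) P P')
    (N : Ω → Measure (TimeInterval ζ)) (hN : ∀ ω, N ω = ∑ j, Nj j ω)
    (M : Ω → Measure (TimeInterval ζ))
    (hM : ∀ ω, M ω = obsMeasure l (fun x ω => ∑ j, Yj j x ω) ω)
    (hNM : ∀ A, MeasurableSet A → P {ω | 0 < N ω A ∧ M ω A = 0} = 0)
    -- the family of partitions, the weights and the penalty
    (𝓜 : Set (SetPartition (TimeInterval ζ))) (h𝓜 : 𝓜.Countable)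
    (h𝓜_meas : ∀ m ∈ 𝓜, IsMeasurablePartition m)
    (δ : ℝ) (hδ : 1 ≤ δ)
    (hH : ∀ m ∈ 𝓜, ∀ m' ∈ 𝓜,
      ((refine m m').parts.card : ℝ) ≤ δ * ((m.parts.card : ℝ) + (m'.parts.card : ℝ)))
    (Δ : 𝓜 → ℝ≥0) (η : ℝ) (hη : η = (k : ℝ) * ((k : ℝ) + ∫ x, (s x : ℝ) ∂l)⁻¹)
    (S : ℝ) (hS : HasSum (fun m => Real.exp (-(η * (Δ m : ℝ)))) S)
    (pen : 𝓜 → ℝ≥0)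
    (hpen : ∀ m : 𝓜, 16 * δ * (m.1.parts.card : ℝ) * ((k : ℝ) + κ) + 404 * (k : ℝ) * (Δ m : ℝ) ≤
      (pen m : ℝ))
    -- the selected partition
    (ε : ℝ) (hε : 0 < ε)
    (mhat : Ω → 𝓜) (hmhat : ∀ᵐ ω ∂P, IsSelected P N M 𝓜 pen ε ω (mhat ω)) :
    ∫⁻ ω, hellingerSq (M ω) (histEst P N M (mhat ω) ω) s ∂P ≤
        390 * ((∫⁻ ω, ⨅ m : 𝓜, (biasSq P M s m ω + (pen m : ℝ≥0∞)) ∂P)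
          + ENNReal.ofReal (404 * (k : ℝ) * η⁻¹ * S ^ 2)) + ENNReal.ofReal ε ∧
      390 * ((∫⁻ ω, ⨅ m : 𝓜, (biasSq P M s m ω + (pen m : ℝ≥0∞)) ∂P)
          + ENNReal.ofReal (404 * (k : ℝ) * η⁻¹ * S ^ 2)) + ENNReal.ofReal ε ≤
        390 * ((⨅ m : 𝓜, ((∫⁻ ω, biasSq P M s m ω ∂P) + (pen m : ℝ≥0∞)))
          + ENNReal.ofReal (404 * (k : ℝ) * η⁻¹ * S ^ 2)) + ENNReal.ofReal ε := by
  -- The bounds on mass, values and means are properties of the laws, so they pass from `Nstar` and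
  -- `Ystar` to the copies.
  have hNk' : ∀ j, ∀ᵐ ω ∂P, Nj j ω univ ≤ (k : ℝ≥0∞) := fun j =>
    (hNj_law j).symm.ae_snd (p := fun ν => ν univ ≤ (k : ℝ≥0∞))
      (Measure.measurable_coe MeasurableSet.univ measurableSet_Iic) hNk
  have hY1 : ∀ j x, ∀ᵐ ω ∂P, Yj j x ω ≤ 1 := fun j x =>
    (hYj_law j).symm.ae_snd (p := fun f => f x ≤ 1)
      (measurable_pi_apply x measurableSet_Iic) (ae_of_all _ fun ω => hYstar_le x ω)
  have hmean : ∀ j J, MeasurableSet J →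
      ∫⁻ ω, Nj j ω J ∂P = ∫⁻ x in J, s x * ∫⁻ ω, Yj j x ω ∂P ∂l := by
    intro j J hJ
    have e1 := ((hNj_law j).comp (Measure.measurable_coe hJ)).lintegral_eq
    simp only [Function.comp_def] at e1
    rw [e1, lintegral_measure_eq_of_Iic hs hNstar (ENNReal.natCast_lt_top k) hNk hYstar haalen hJ]
    refine lintegral_congr fun x => ?_
    have e2 := ((hYj_law j).comp (measurable_pi_apply x).coe_nnreal_ennreal).lintegral_eq
    simp only [Function.comp_def] at e2
    rw [e2]
  refine ⟨lintegral_hellingerSq_selected_le hs hsint hNj hNj_indep hk hNk' hYj hYj_indep hY1 hmean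
    hN hM hNM h𝓜 h𝓜_meas hη hS (fun m m' => ?_) hmhat, ?_⟩
  · have h1 := hH m m.2 m' m'.2
    have h2 := hpen m
    have h3 := hpen m'
    have hk' : (0 : ℝ) ≤ k := Nat.cast_nonneg k
    have h4 := mul_le_mul_of_nonneg_left h1 hk'
    have h5 : 0 ≤ δ * ((m.1.parts.card : ℝ) + m'.1.parts.card) * κ := by positivity
    have h6 : 0 ≤ (k : ℝ) * ((Δ m : ℝ) + Δ m') := by positivity
    -- Adding the two penalty conditions, `16 δ k (|m| + |m'|)` covers `16 k` times the number of
    -- cells of the refinement, and `404 ≥ 4` covers the weights; the term in `κ` is nonnegative.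
    nlinarith
  · gcongr
    exact lintegral_iInf_biasSq_add_le pen M s
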